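/- **Setting.** Let $r\ge 1$, let $\nu_0,\nu_1,\dots,\nu_r$ be positive integers, $\nu:=\nu_1+\dots+\nu_r$ and $N:=\nu_0+\nu$. Let $\mathcal V_{lk}\subset \mathrm{Mat}(\nu_l,\nu_k;\mathbb R)$ $(1\le k<l\le r)$ be real vector spaces and $\mathcal W_k\subset\mathrm{Mat}(\nu_k,\nu_0;\mathbb C)$ $(1\le k\le r)$ complex vector spaces such that - (V1) $A\in\mathcal V_{lk},\ B\in\mathcal V_{ki}\Rightarrow AB\in\mathcal V_{li}$ for $i<k<l$; - (V2) $A\in\mathcal V_{li},\ B\in\mathcal V_{ki}\Rightarrow A\,{}^tB\in\mathcal V_{lk}$ for $i<k<l$; - (V3) $A\in\mathcal V_{lk}\Rightarrow A\,{}^tA\in\mathbb R I_{\nu_l}$ for $k<l$; - (W1) $A\in\mathcal V_{lk},\ C\in\mathcal W_k\Rightarrow AC\in\mathcal W_l$ for $k<l$; - (W2) $C\in\mathcal W_l,\ C'\in\mathcal W_k\Rightarrow C\,{}^t\overline{C'}\in(\mathcal V_{lk})_{\mathbb C}$ for $k<l$; - (W3) $C\in\mathcal W_k\Rightarrow C\,{}^t\overline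 C+\overline C\,{}^tC\in\mathbb R I_{\nu_k}$ for all $k$. Let $\mathcal V$ be the space of real symmetric $\nu\times\nu$ matrices $X$, divided into blocks $X_{lk}\in\mathrm{Mat}(\nu_l,\nu_k;\mathbb R)$, such that $X_{kk}\in\mathbb R I_{\nu_k}$ for all $k$ and $X_{lk}\in\mathcal V_{lk}$ for $k<l$. Let $\Omega\subset\mathcal V$ be the cone of positive definite elements of $\mathcal V$. Let $\mathcal W\subset\mathrm{Mat}(\nu,\nu_0;\mathbb C)$ be the space of matrices $U$ with blocks $U_k\in\mathcal W_k$. Put $F(U,U'):=\tfrac14(U\,{}^t\overline{U'}+\overline{U'}\,{}^tU)$. The associated homogeneous Siegel domain is $$\mathcal S:=\{(Z,U)\in\mathcal V_{\mathbb C}\times\mathcal W \mid \mathrm{Im}\,Z-F(U,U)\in\Omega\}.$$ For $n\ge 1$ let $\mathcal D_n$ be the Siegel upper half plane of complex symmetric $n\times n$ matrices with positive definite imaginary part. Let $$\Phi(Z,U):=\begin{pmatrix} iI_{\nu_0} & {}^tU\\ U & Z-\tfrac i2\,U\,{}^tU\end{pmatrix}\qquad((Z,U)\in\mathcal S),$$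 and for $1\le n\le N$ let $\Phi_n(\zeta)$ be the upper left $n\times n$ block of the $N\times N$ matrix $\Phi(\zeta)$. For a domain $D$ in a finite-dimensional complex vector space, let $K_D$ be its Bergman kernel, i.e. the reproducing kernel of the space of holomorphic functions on $D$ that are square integrable for Lebesgue measure. The Bergman metric is the Hermitian form $\sum_{j,k}\frac{\partial^2\log K_D(z,z)}{\partial z_j\partial\overline{z_k}}X_j\overline{X_k}$, and the Bergman distance $\beta_D(z,w)$ is the infimum of the lengths, with respect to this metric, of the $C^1$ curves in $D$ from $z$ to $w$. **Proposition.** For every $n$ with $1\le n\le N$, the map $\Phi_n$ sends $\mathcal S$ into $\mathcal D_n$, and there exists a constant $M_n>0$ such that $$\beta_{\mathcal D_n}(\Phi_n(\zeta),\Phi_n(\eta))\le M_n\,\beta_{\mathcal S}(\zeta,\eta)\qquad\text{for all }\zeta,\eta\in\mathcal S.$$ -/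

import Mathlib

open scoped Matrix Matrix.Norms.Elementwise ENNReal NNReal ContDiff

/-! ## Bergman kernel, metric and distance of a domain in a finite-dimensional complex space -/

namespace Bergman

noncomputable section

variable {E : Type*} [NormedAddCommGroup E] [NormedSpace ℂ E] [FiniteDimensional ℂ E]

/-- Lebesgue measure on a finite-dimensional complex vector space: the Haar measure, on the Borel
σ-algebra (its normalization does not influence the Bergman metric). -/
def lebesgue (E : Type*) [NormedAddCommGroup E] [NormedSpace ℂ E] [FiniteDimensional ℂ E] :
    @MeasureTheory.Measure E (borel E) :=
  letI : MeasurableSpace E := borel E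
  haveI : BorelSpace E := ⟨rfl⟩
  haveI : ProperSpace E := FiniteDimensional.proper ℂ E
  MeasureTheory.Measure.addHaar

/-- `f` belongs to the Bergman space of `D`: it is holomorphic and square integrable on `D`. -/
def MemBergmanSpace (D : Set E) (f : E → ℂ) : Prop :=
  DifferentiableOn ℂ f D ∧ MeasureTheory.MemLp f 2 ((lebesgue E).restrict D)

/-- `K` is a reproducing kernel of the Bergman space of `D`. -/
def IsBergmanKernel (D : Set E) (K : E → E → ℂ) : Prop :=
  ∀ w ∈ D, MemBergmanSpace D (fun z => K z w) ∧
    ∀ f : E → ℂ, MemBergmanSpace D f → f w = ∫ z in D, f z * star (K z w) ∂(lebesgue E)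

/-- The reproducing property determines the kernel on `D × D`. -/
theorem IsBergmanKernel.eq_on {D : Set E} {K K' : E → E → ℂ}
    (hK : IsBergmanKernel D K) (hK' : IsBergmanKernel D K') {z w : E} (hz : z ∈ D) (hw : w ∈ D) :
    K z w = K' z w := by
  let : MeasurableSpace E := borel E
  have key : ∀ {A B : E → E → ℂ}, IsBergmanKernel D A → IsBergmanKernel D B →
      ∀ {z w : E}, z ∈ D → w ∈ D → A z w = star (B w z) := by
    intro A B hA hB z w hz hw
    rw [(hB z hz).2 _ (hA w hw).1, (hA w hw).2 _ (hB z hz).1]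
    have := integral_conj (𝕜 := ℂ) (μ := (lebesgue E).restrict D)
      (f := fun ζ => B ζ z * star (A ζ w))
    refine Eq.trans ?_ this
    congr 1
    ext ζ
    simp [mul_comm]
  rw [key hK hK' hz hw, key hK' hK' hz hw]

open Classical in
/-- The Bergman kernel `K_D` of a domain `D`: the reproducing kernel of its Bergman space. -/
def kernel (D : Set E) : E → E → ℂ :=
  if h : ∃ K : E → E → ℂ, IsBergmanKernel D K then h.choose else 0

theorem isBergmanKernel_kernel {D : Set E} (h : ∃ K : E → E → ℂ, IsBergmanKernel D K) :
    IsBergmanKernel D (kernel D) := by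
  rw [kernel, dif_pos h]
  exact h.choose_spec

/-- The Levi form `∑ ∂²u / ∂z_j ∂z̄_k (p) X_j X̄_k` of a function `u`, which equals a quarter of
`D²u(p)(X, X) + D²u(p)(iX, iX)`, with real second derivatives. -/
def leviForm (u : E → ℝ) (p X : E) : ℝ :=
  (iteratedFDeriv ℝ 2 u p ![X, X] +
    iteratedFDeriv ℝ 2 u p ![Complex.I • X, Complex.I • X]) / 4

/-- The Bergman metric of `D` at `p`, evaluated at `(X, X)`: the Levi form of `log K_D(z, z)`. -/
def metric (D : Set E) (p X : E) : ℝ :=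
  leviForm (fun z => Real.log (kernel D z z).re) p X

/-- The length of the curve `γ` on `[0, 1]` with respect to the Bergman metric of `D`. -/
def curveLength (D : Set E) (γ : ℝ → E) : ℝ≥0∞ :=
  ∫⁻ t in Set.Icc (0 : ℝ) 1,
    ENNReal.ofReal (Real.sqrt (metric D (γ t) (derivWithin γ (Set.Icc 0 1) t)))

/-- The Bergman distance `β_D(z, w)`: the infimum of the lengths of the `C¹` curves in `D` from `z`
to `w` (with the value `∞` if there is no such curve). -/
def dist (D : Set E) (z w : E) : ℝ≥0∞ :=
  ⨅ (γ : ℝ → E) (_ : ContDiffOn ℝ 1 γ (Set.Icc 0 1) ∧ Set.MapsTo γ (Set.Icc 0 1) D ∧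
    γ 0 = z ∧ γ 1 = w), curveLength D γ

end

end Bergman

/-! ## Complex matrix spaces -/

noncomputable section

/-- Entrywise real part of a complex matrix. -/
def matRe {m n : Type*} (A : Matrix m n ℂ) : Matrix m n ℝ := A.map Complex.re

/-- Entrywise imaginary part of a complex matrix. -/
def matIm {m n : Type*} (A : Matrix m n ℂ) : Matrix m n ℝ := A.map Complex.im

/-- The complexification `S + iS` of a real space of real matrices, as a space of complex
matrices. -/
def complexify {m n : Type*} (S : Submodule ℝ (Matrix m n ℝ)) : Submodule ℂ (Matrix m n ℂ) where
  carrier := {A | matRe A ∈ S ∧ matIm A ∈ S}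
  zero_mem' := by
    have h1 : matRe (0 : Matrix m n ℂ) = 0 := by ext; simp [matRe]
    have h2 : matIm (0 : Matrix m n ℂ) = 0 := by ext; simp [matIm]
    simp [h1, h2, S.zero_mem]
  add_mem' := by
    rintro A B ⟨hA, hA'⟩ ⟨hB, hB'⟩
    have h1 : matRe (A + B) = matRe A + matRe B := by ext; simp [matRe]
    have h2 : matIm (A + B) = matIm A + matIm B := by ext; simp [matIm]
    exact ⟨h1 ▸ S.add_mem hA hB, h2 ▸ S.add_mem hA' hB'⟩
  smul_mem' := by
    rintro c A ⟨hA, hA'⟩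
    have h1 : matRe (c • A) = c.re • matRe A - c.im • matIm A := by ext; simp [matRe, matIm]
    have h2 : matIm (c • A) = c.re • matIm A + c.im • matRe A := by ext; simp [matRe, matIm]
    exact ⟨h1 ▸ S.sub_mem (S.smul_mem _ hA) (S.smul_mem _ hA'),
      h2 ▸ S.add_mem (S.smul_mem _ hA') (S.smul_mem _ hA)⟩

/-- The space `Sym(n, R)` of symmetric matrices. -/
def symMatrices (R : Type*) [CommRing R] (n : ℕ) : Submodule R (Matrix (Fin n) (Fin n) R) where
  carrier := {A | A.IsSymm}
  zero_mem' := Matrix.isSymm_zero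
  add_mem' hA hB := hA.add hB
  smul_mem' c _ hA := hA.smul c

/-- The Siegel upper half plane `𝒟_n`: the complex symmetric `n × n` matrices with positive definite
imaginary part. -/
def siegelUpperHalfPlane (n : ℕ) : Set (symMatrices ℂ n) :=
  {Z | (matIm (Z : Matrix (Fin n) (Fin n) ℂ)).PosDef}

/-- The truncation `Z ↦ Z^{[n]}` of a symmetric matrix to its upper left `n × n` block. -/
def truncate {n N : ℕ} (h : n ≤ N) (Z : symMatrices ℂ N) : symMatrices ℂ n :=
  ⟨(Z : Matrix (Fin N) (Fin N) ℂ).submatrix (Fin.castLE h) (Fin.castLE h), Z.2.submatrix _⟩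

/-! ## Homogeneous Siegel domains in matrix realization -/

/-- The spaces of blocks `𝒱_{lk} ⊂ Mat(ν_l, ν_k; ℝ)` (for `k < l`; the other values of `V` are never
used) and `𝒲_k ⊂ Mat(ν_k, ν₀; ℂ)` from which a homogeneous Siegel domain is built. -/
structure SiegelData (r : ℕ) (ν : Fin r → ℕ) (ν₀ : ℕ) where
  V : ∀ l k : Fin r, Submodule ℝ (Matrix (Fin (ν l)) (Fin (ν k)) ℝ)
  W : ∀ k : Fin r, Submodule ℂ (Matrix (Fin (ν k)) (Fin ν₀) ℂ)
  V1 : ∀ i k l, i < k → k < l → ∀ A ∈ V l k, ∀ B ∈ V k i, A * B ∈ V l i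
  V2 : ∀ i k l, i < k → k < l → ∀ A ∈ V l i, ∀ B ∈ V k i, A * Bᵀ ∈ V l k
  V3 : ∀ k l, k < l → ∀ A ∈ V l k, ∃ c : ℝ, A * Aᵀ = c • (1 : Matrix (Fin (ν l)) (Fin (ν l)) ℝ)
  W1 : ∀ k l, k < l → ∀ A ∈ V l k, ∀ C ∈ W k, A.map Complex.ofReal * C ∈ W l
  W2 : ∀ k l, k < l → ∀ C ∈ W l, ∀ C' ∈ W k, C * C'ᴴ ∈ complexify (V l k)
  W3 : ∀ k, ∀ C ∈ W k, ∃ c : ℝ, C * Cᴴ + C.map star * Cᵀ =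
    (c : ℂ) • (1 : Matrix (Fin (ν k)) (Fin (ν k)) ℂ)

namespace SiegelData

variable {r : ℕ} {ν : Fin r → ℕ} {ν₀ : ℕ}

/-- The row indices of a `ν × ν` matrix with `ν = ν_1 + ⋯ + ν_r`: pairs (block, index in block),
which come in lexicographic order. -/
abbrev Idx (ν : Fin r → ℕ) : Type := Σ k : Fin r, Fin (ν k)

/-- The real space `𝒱` of symmetric matrices with diagonal blocks in `ℝ I` and lower off-diagonal
blocks in `𝒱_{lk}`. -/
def realSpace (S : SiegelData r ν ν₀) : Submodule ℝ (Matrix (Idx ν) (Idx ν) ℝ) where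
  carrier := {X | X.IsSymm ∧
    (∀ k, ∃ x : ℝ, X.submatrix (Sigma.mk k) (Sigma.mk k) = x • (1 : Matrix _ _ ℝ)) ∧
    ∀ k l, k < l → X.submatrix (Sigma.mk l) (Sigma.mk k) ∈ S.V l k}
  zero_mem' := ⟨Matrix.isSymm_zero, fun k => ⟨0, by ext; simp⟩, fun k l _ => (S.V l k).zero_mem⟩
  add_mem' := by
    rintro X Y ⟨h1, h2, h3⟩ ⟨h1', h2', h3'⟩
    refine ⟨h1.add h1', fun k => ?_, fun k l h => (S.V l k).add_mem (h3 k l h) (h3' k l h)⟩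
    obtain ⟨x, hx⟩ := h2 k
    obtain ⟨y, hy⟩ := h2' k
    exact ⟨x + y, by rw [add_smul, ← hx, ← hy]; rfl⟩
  smul_mem' := by
    rintro c X ⟨h1, h2, h3⟩
    refine ⟨h1.smul c, fun k => ?_, fun k l h => (S.V l k).smul_mem c (h3 k l h)⟩
    obtain ⟨x, hx⟩ := h2 k
    exact ⟨c * x, by rw [mul_smul, ← hx]; rfl⟩

/-- The cone `Ω_𝒱` of positive definite matrices in `𝒱`. -/
def cone (S : SiegelData r ν ν₀) : Set (Matrix (Idx ν) (Idx ν) ℝ) :=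
  {X | X ∈ S.realSpace ∧ X.PosDef}

/-- The complex space `𝒲` of the matrices `U` with blocks `U_k ∈ 𝒲_k`. -/
def complexSpace (S : SiegelData r ν ν₀) : Submodule ℂ (Matrix (Idx ν) (Fin ν₀) ℂ) where
  carrier := {U | ∀ k, U.submatrix (Sigma.mk k) id ∈ S.W k}
  zero_mem' := fun k => (S.W k).zero_mem
  add_mem' h h' := fun k => (S.W k).add_mem (h k) (h' k)
  smul_mem' c _ h := fun k => (S.W k).smul_mem c (h k)

/-- The ambient complex vector space `𝒱_ℂ × 𝒲`. -/
abbrev Ambient (S : SiegelData r ν ν₀) : Type := complexify S.realSpace × S.complexSpace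

/-- The Hermitian map `F(U, U') = (U U'^* + conj(U') U^t) / 4`. -/
def form (U U' : Matrix (Idx ν) (Fin ν₀) ℂ) : Matrix (Idx ν) (Idx ν) ℂ :=
  (1 / 4 : ℂ) • (U * U'ᴴ + U'.map star * Uᵀ)

/-- The Siegel domain: the pairs `(Z, U)` with `Im Z - F(U, U) ∈ Ω_𝒱` (the matrix `F(U, U)` is
real). -/
def domain (S : SiegelData r ν ν₀) : Set S.Ambient :=
  {ζ | matIm (ζ.1 : Matrix (Idx ν) (Idx ν) ℂ) -
    matRe (form (ζ.2 : Matrix (Idx ν) (Fin ν₀) ℂ) ζ.2) ∈ S.cone}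

/-- The order preserving identification of the indices of `N × N` matrices,
`N = ν₀ + ν_1 + ⋯ + ν_r`, with the indices of the block decomposition. -/
def idxEquiv (ν : Fin r → ℕ) (ν₀ : ℕ) : Fin ν₀ ⊕ Idx ν ≃ Fin (ν₀ + ∑ k, ν k) :=
  (Equiv.sumCongr (Equiv.refl _) finSigmaFinEquiv).trans finSumFinEquiv

theorem isSymm_of_mem (S : SiegelData r ν ν₀) {Z : Matrix (Idx ν) (Idx ν) ℂ}
    (hZ : Z ∈ complexify S.realSpace) : Z.IsSymm := by
  ext i j
  apply Complex.ext
  · exact congrFun (congrFun hZ.1.1 i) j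
  · exact congrFun (congrFun hZ.2.1 i) j

/-- The embedding `Φ(Z, U) = [[i I, U^t], [U, Z - (i/2) U U^t]]`. -/
def embedding (S : SiegelData r ν ν₀) (ζ : S.Ambient) : symMatrices ℂ (ν₀ + ∑ k, ν k) :=
  ⟨Matrix.reindex (idxEquiv ν ν₀) (idxEquiv ν ν₀)
    (Matrix.fromBlocks (Complex.I • (1 : Matrix (Fin ν₀) (Fin ν₀) ℂ))
      (ζ.2 : Matrix (Idx ν) (Fin ν₀) ℂ)ᵀ
      (ζ.2 : Matrix (Idx ν) (Fin ν₀) ℂ)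
      ((ζ.1 : Matrix (Idx ν) (Idx ν) ℂ) - (Complex.I / 2) •
        ((ζ.2 : Matrix (Idx ν) (Fin ν₀) ℂ) * (ζ.2 : Matrix (Idx ν) (Fin ν₀) ℂ)ᵀ))), by
    refine Matrix.IsSymm.submatrix (Matrix.IsSymm.fromBlocks ?_ rfl ?_) _
    · exact Matrix.isSymm_one.smul _
    · refine (S.isSymm_of_mem ζ.1.2).sub (Matrix.IsSymm.smul ?_ _)
      rw [Matrix.IsSymm, Matrix.transpose_mul, Matrix.transpose_transpose]⟩

/-- The map `Φ_n`: the embedding `Φ` followed by truncation to the upper left `n × n` block. -/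
def truncatedEmbedding (S : SiegelData r ν ν₀) (n : ℕ) (hn : n ≤ ν₀ + ∑ k, ν k) (ζ : S.Ambient) :
    symMatrices ℂ n :=
  truncate hn (S.embedding ζ)

end SiegelData

end

/-! ## Holomorphic maps on open subsets of complex normed spaces -/

section Holomorphic

open Metric Set Filter Topology

variable {E F : Type*} [NormedAddCommGroup E] [NormedSpace ℂ E]
  [NormedAddCommGroup F] [NormedSpace ℂ F]

theorem norm_fderiv_le_of_forall_ball_norm_le {f : E → F} {z : E} {R C : ℝ} (hR : 0 < R)
    (hf : DifferentiableOn ℂ f (ball z R)) (hC : ∀ w ∈ ball z R, ‖f w‖ ≤ C) :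
    ‖fderiv ℂ f z‖ ≤ 2 * C / R := by
  refine Complex.norm_fderiv_le_div_of_mapsTo_ball hf (fun w hw => ?_) hR
  rw [mem_closedBall, dist_eq_norm]
  linarith [norm_sub_le (f w) (f z), hC w hw, hC z (mem_ball_self hR)]

theorem norm_sub_sub_fderiv_le_of_forall_ball_norm_le [CompleteSpace F] {f : E → F} {z h : E} {R C : ℝ}
    (hf : DifferentiableOn ℂ f (ball z R)) (hC : ∀ w ∈ ball z R, ‖f w‖ ≤ C) (hh : ‖h‖ < R) :
    ‖f (z + h) - f z - fderiv ℂ f z h‖ ≤ 4 * C / R ^ 2 * ‖h‖ ^ 2 := by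
  rcases eq_or_ne h 0 with rfl | hne
  · simp
  have hh0 : 0 < ‖h‖ := norm_pos_iff.2 hne
  have hR : 0 < R := hh0.trans hh
  set ρ := R / ‖h‖ with hρ
  have hρ1 : 1 < ρ := by rwa [hρ, one_lt_div hh0]
  have hρ0 : 0 < ρ := one_pos.trans hρ1
  set g : ℂ → F := fun t => f (z + t • h) with hg
  have hmem : ∀ t ∈ ball (0 : ℂ) ρ, z + t • h ∈ ball z R := by
    intro t ht
    rw [mem_ball_zero_iff, hρ, lt_div_iff₀ hh0] at ht
    simpa [norm_smul] using ht
  have hgd : DifferentiableOn ℂ g (ball 0 ρ) :=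
    hf.comp (by fun_prop) hmem
  have hgC : ∀ t ∈ ball (0 : ℂ) ρ, ‖g t‖ ≤ C := fun t ht => hC _ (hmem t ht)
  have h0 : (0 : ℂ) ∈ ball (0 : ℂ) ρ := mem_ball_self hρ0
  have h1 : (1 : ℂ) ∈ ball (0 : ℂ) ρ := by simpa using hρ1
  have hd1 : ∀ t ∈ ball (0 : ℂ) ρ, ‖dslope g 0 t‖ ≤ 2 * C / ρ := fun t ht =>
    Complex.norm_dslope_le_div_of_mapsTo_ball hgd (fun w hw => by
      rw [mem_closedBall, dist_eq_norm]
      linarith [norm_sub_le (g w) (g 0), hgC w hw, hgC 0 h0]) ht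
  have hgd1 : DifferentiableOn ℂ (dslope g 0) (ball 0 ρ) :=
    (Complex.differentiableOn_dslope (ball_mem_nhds _ hρ0)).2 hgd
  have hd2 : ‖dslope (dslope g 0) 0 1‖ ≤ 2 * (2 * C / ρ) / ρ :=
    Complex.norm_dslope_le_div_of_mapsTo_ball hgd1 (fun w hw => by
      rw [mem_closedBall, dist_eq_norm]
      linarith [norm_sub_le (dslope g 0 w) (dslope g 0 0), hd1 w hw, hd1 0 h0]) h1
  have hderiv : deriv g 0 = fderiv ℂ f z h := by
    have hfz : HasFDerivAt f (fderiv ℂ f z) (z + (0 : ℂ) • h) := by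
      rw [zero_smul, add_zero]
      exact (hf.differentiableAt (ball_mem_nhds z hR)).hasFDerivAt
    have hl : HasDerivAt (fun t : ℂ => z + t • h) h 0 := by
      simpa using ((hasDerivAt_id (0 : ℂ)).smul_const h).const_add z
    exact (hfz.comp_hasDerivAt (0 : ℂ) hl).deriv
  have heq : dslope (dslope g 0) 0 1 = f (z + h) - f z - fderiv ℂ f z h := by
    rw [dslope_of_ne _ one_ne_zero, slope_def_module, dslope_same,
      dslope_of_ne _ one_ne_zero, slope_def_module, hderiv]
    simp [hg]
  rw [← heq]
  refine hd2.trans (le_of_eq ?_)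
  rw [hρ]
  field_simp
  ring

theorem exists_forall_ball_norm_le {E F : Type*} [NormedAddCommGroup E] [NormedAddCommGroup F]
    {f : E → F} {U : Set E} (hU : IsOpen U)
    (hf : ContinuousOn f U) {z : E} (hz : z ∈ U) :
    ∃ r > 0, ∃ C, ball z r ⊆ U ∧ ∀ w ∈ ball z r, ‖f w‖ ≤ C := by
  have h1 : ∀ᶠ w in 𝓝 z, ‖f w‖ < ‖f z‖ + 1 :=
    (hf.continuousAt (hU.mem_nhds hz)).norm.eventually_lt continuousAt_const (by simp)
  obtain ⟨r, hr, h⟩ := Metric.eventually_nhds_iff_ball.1 (h1.and (hU.eventually_mem hz))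
  exact ⟨r, hr, ‖f z‖ + 1, fun w hw => (h w hw).2, fun w hw => (h w hw).1.le⟩

/-- The derivative of a holomorphic map is continuous. -/
theorem DifferentiableOn.continuousOn_fderiv_complex {f : E → F} {U : Set E} (hU : IsOpen U)
    (hf : DifferentiableOn ℂ f U) : ContinuousOn (fderiv ℂ f) U := by
  intro z₀ hz₀
  obtain ⟨R, hR, C, hRU, hC⟩ := exists_forall_ball_norm_le hU hf.continuousOn hz₀
  set r := R / 3 with hr
  have hr0 : 0 < r := by positivity
  have hsub : ∀ {x y : E} {a b : ℝ}, x ∈ ball z₀ a → y ∈ ball x b → y ∈ ball z₀ (b + a) := by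
    intro x y a b hx hy
    rw [mem_ball] at *
    linarith [dist_triangle y x z₀]
  have hfd : ∀ x ∈ ball z₀ (r + r), ‖fderiv ℂ f x‖ ≤ 2 * C / r := by
    intro x hx
    have hx' : ball x r ⊆ ball z₀ R := fun y hy => by
      have := hsub hx hy
      rwa [show r + (r + r) = R by rw [hr]; ring] at this
    exact norm_fderiv_le_of_forall_ball_norm_le hr0 (hf.mono (hx'.trans hRU))
      fun w hw => hC w (hx' hw)
  have hss : ball z₀ (r + r) ⊆ U := (ball_subset_ball (by rw [hr]; linarith)).trans hRU
  have hlip : ∀ x ∈ ball z₀ (r + r), ∀ y ∈ ball z₀ (r + r),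
      ‖f y - f x‖ ≤ 2 * C / r * ‖y - x‖ := fun x hx y hy =>
    (convex_ball z₀ (r + r)).norm_image_sub_le_of_norm_fderiv_le (𝕜 := ℂ)
      (fun w hw => hf.differentiableAt (hU.mem_nhds (hss hw))) hfd hx hy
  have hlip' : ∀ w ∈ ball z₀ r,
      ‖fderiv ℂ f w - fderiv ℂ f z₀‖ ≤ 2 * (2 * C / r * ‖w - z₀‖) / r := by
    intro w hw
    have hm : ∀ x ∈ ball z₀ r, x + (w - z₀) ∈ ball z₀ (r + r) := by
      intro x hx
      refine hsub hw ?_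
      rw [mem_ball, dist_eq_norm] at hx ⊢
      rwa [show x + (w - z₀) - w = x - z₀ by abel]
    have hm' : ∀ x ∈ ball z₀ r, x ∈ ball z₀ (r + r) := fun x hx =>
      ball_subset_ball (by linarith) hx
    have hd1 : DifferentiableOn ℂ (fun x => f (x + (w - z₀))) (ball z₀ r) :=
      hf.comp (by fun_prop) fun x hx => hss (hm x hx)
    have hd2 : DifferentiableOn ℂ f (ball z₀ r) := hf.mono fun x hx => hss (hm' x hx)
    have := norm_fderiv_le_of_forall_ball_norm_le (f := fun x => f (x + (w - z₀)) - f x) hr0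
      (hd1.sub hd2) (C := 2 * C / r * ‖w - z₀‖) fun x hx => by
        simpa using hlip x (hm' x hx) _ (hm x hx)
    rw [fderiv_fun_sub (hd1.differentiableAt (ball_mem_nhds _ hr0))
      (hd2.differentiableAt (ball_mem_nhds _ hr0)), fderiv_comp_add_right] at this
    simpa using this
  refine ContinuousAt.continuousWithinAt ?_
  rw [ContinuousAt, tendsto_iff_norm_sub_tendsto_zero]
  have hlim : Tendsto (fun w => 2 * (2 * C / r * ‖w - z₀‖) / r) (𝓝 z₀) (𝓝 0) := by
    have : ContinuousAt (fun w => 2 * (2 * C / r * ‖w - z₀‖) / r) z₀ := by fun_prop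
    simpa [ContinuousAt] using this
  exact squeeze_zero' (Eventually.of_forall fun w => norm_nonneg _)
    (eventually_of_mem (ball_mem_nhds z₀ hr0) hlip') hlim

/-- The directional derivatives of a holomorphic map are holomorphic. -/
theorem differentiableOn_fderiv_apply_complex [CompleteSpace F] {f : E → F} {U : Set E}
    (hU : IsOpen U) (hf : DifferentiableOn ℂ f U) (h : E) :
    DifferentiableOn ℂ (fun z => fderiv ℂ f z h) U := by
  intro z₀ hz₀
  have hfc := hf.continuousOn_fderiv_complex hU
  obtain ⟨R, hR, C, hRU, hC⟩ := exists_forall_ball_norm_le hU hfc hz₀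
  obtain ⟨s, hs, hsh⟩ : ∃ s : ℝ, 0 < s ∧ s * ‖h‖ < R / 2 :=
    ⟨R / 2 / (‖h‖ + 1), by positivity, by
      rw [div_mul_eq_mul_div, div_lt_iff₀ (by positivity)]
      nlinarith [norm_nonneg h]⟩
  have hmem : ∀ z ∈ ball z₀ (R / 2), ∀ t ∈ closedBall (0 : ℂ) s, z + t • h ∈ ball z₀ R := by
    intro z hz t ht
    rw [mem_ball, dist_eq_norm] at *
    rw [mem_closedBall_zero_iff] at ht
    calc ‖z + t • h - z₀‖ = ‖(z - z₀) + t • h‖ := by congr 1; abel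
      _ ≤ ‖z - z₀‖ + ‖t‖ * ‖h‖ := (norm_add_le _ _).trans (by rw [norm_smul])
      _ ≤ ‖z - z₀‖ + s * ‖h‖ := by gcongr
      _ < R := by linarith
  have hcm : ∀ θ : ℝ, circleMap 0 s θ ∈ closedBall (0 : ℂ) s := fun θ =>
    circleMap_mem_closedBall 0 hs.le θ
  set w : ℝ → ℂ := fun θ => deriv (circleMap 0 s) θ * ((circleMap 0 s θ - 0) ^ 2)⁻¹ with hw
  have hwc : Continuous w := by
    have h1 : Continuous (deriv (circleMap 0 s)) := by
      simp only [funext (deriv_circleMap 0 s)]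
      fun_prop
    refine h1.mul (Continuous.inv₀ (by fun_prop) fun θ => ?_)
    simpa using hs.ne'
  have hwn : ∀ θ, ‖w θ‖ = s⁻¹ := by
    intro θ
    simp only [hw, deriv_circleMap]
    simp [abs_of_pos hs]
    field_simp
  have hrep : ∀ z ∈ ball z₀ (R / 2), fderiv ℂ f z h = (2 * Real.pi * Complex.I : ℂ)⁻¹ •
      ∫ θ in (0 : ℝ)..2 * Real.pi, w θ • f (z + circleMap 0 s θ • h) := by
    intro z hz
    have hzU : ball z₀ (R / 2) ⊆ U := (ball_subset_ball (by linarith)).trans hRU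
    have hgd : DifferentiableOn ℂ (fun t : ℂ => f (z + t • h))
        {t : ℂ | z + t • h ∈ U} := hf.comp (by fun_prop) fun t ht => ht
    have hO : IsOpen {t : ℂ | z + t • h ∈ U} := hU.preimage (by fun_prop)
    have := Complex.two_pi_I_inv_smul_circleIntegral_sub_sq_inv_smul_of_differentiable hO
      (c := 0) (R := s) (w₀ := 0) (fun t ht => hRU (hmem z hz t ht)) hgd (mem_ball_self hs)
    have hfz : HasFDerivAt f (fderiv ℂ f z) (z + (0 : ℂ) • h) := by
      rw [zero_smul, add_zero]
      exact (hf.differentiableAt (hU.mem_nhds (hzU hz))).hasFDerivAt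
    have hl : HasDerivAt (fun t : ℂ => z + t • h) h 0 := by
      simpa using ((hasDerivAt_id (0 : ℂ)).smul_const h).const_add z
    have hd : deriv (fun t : ℂ => f (z + t • h)) 0 = fderiv ℂ f z h :=
      (hfz.comp_hasDerivAt (0 : ℂ) hl).deriv
    rw [← hd, ← this, circleIntegral]
    simp only [smul_smul, hw]
  have hdiff : DifferentiableAt ℂ (fun z => ∫ θ in (0 : ℝ)..2 * Real.pi,
      w θ • f (z + circleMap 0 s θ • h)) z₀ := by
    have hb : ball z₀ (R / 2) ∈ 𝓝 z₀ := ball_mem_nhds _ (by positivity)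
    have hcont : ∀ z ∈ ball z₀ (R / 2), Continuous
        (fun θ : ℝ => w θ • f (z + circleMap 0 s θ • h)) := fun z hz =>
      hwc.smul (hf.continuousOn.comp_continuous (by fun_prop)
        fun θ => hRU (hmem z hz _ (hcm θ)))
    refine (intervalIntegral.hasFDerivAt_integral_of_dominated_of_fderiv_le
      (F' := fun z θ => w θ • fderiv ℂ f (z + circleMap 0 s θ • h))
      (bound := fun _ => s⁻¹ * C) hb
      (eventually_of_mem hb fun z hz => (hcont z hz).aestronglyMeasurable)
      ((hcont z₀ (mem_of_mem_nhds hb)).intervalIntegrable _ _)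
      (Continuous.aestronglyMeasurable (hwc.smul (hfc.comp_continuous (by fun_prop)
        fun θ => hRU (hmem z₀ (mem_of_mem_nhds hb) _ (hcm θ))))) ?_
      intervalIntegrable_const ?_).differentiableAt
    · refine Eventually.of_forall fun θ _ z hz => ?_
      rw [norm_smul, hwn]
      exact mul_le_mul_of_nonneg_left (hC _ (hmem z hz _ (hcm θ))) (by positivity)
    · refine Eventually.of_forall fun θ _ z hz => ?_
      have h1 : HasFDerivAt f (fderiv ℂ f (z + circleMap 0 s θ • h)) (z + circleMap 0 s θ • h) :=
        (hf.differentiableAt (hU.mem_nhds (hRU (hmem z hz _ (hcm θ))))).hasFDerivAt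
      exact ((hasFDerivAt_comp_add_right _).2 h1).const_smul (w θ)
  refine DifferentiableAt.differentiableWithinAt ?_
  refine (hdiff.const_smul (2 * Real.pi * Complex.I : ℂ)⁻¹).congr_of_eventuallyEq ?_
  exact eventually_of_mem (ball_mem_nhds z₀ (by positivity)) hrep

/-- A holomorphic map on an open subset of a finite-dimensional space is smooth. -/
theorem DifferentiableOn.contDiffOn_complex [FiniteDimensional ℂ E] [CompleteSpace F]
    {U : Set E} (hU : IsOpen U) (n : ℕ) {f : E → F} (hf : DifferentiableOn ℂ f U) :
    ContDiffOn ℂ n f U := by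
  induction n generalizing f with
  | zero => exact contDiffOn_zero.2 hf.continuousOn
  | succ n ih =>
    rw [Nat.cast_succ, contDiffOn_succ_iff_fderiv_of_isOpen hU]
    refine ⟨hf, by simp, ?_⟩
    rw [contDiffOn_clm_apply]
    exact fun h => ih (differentiableOn_fderiv_apply_complex hU hf h)

end Holomorphic

/-! ## The mean value property for balls of a finite-dimensional complex normed space -/

section MeanValue

open Metric Set Filter Topology MeasureTheory

variable {E : Type*} [NormedAddCommGroup E] [NormedSpace ℂ E] [FiniteDimensional ℂ E]
  [MeasurableSpace E] [BorelSpace E] (μ : Measure E) [μ.IsAddHaarMeasure]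

theorem map_addHaar_linearIsometryEquiv (e : E ≃ₗᵢ[ℂ] E) : μ.map e = μ := by
  have : FiniteDimensional ℝ E := FiniteDimensional.complexToReal E
  set f : E →ₗ[ℝ] E := ((e.toLinearEquiv.restrictScalars ℝ : E ≃ₗ[ℝ] E) : E →ₗ[ℝ] E)
  have hdet : LinearMap.det f ≠ 0 :=
    (LinearEquiv.isUnit_det' (e.toLinearEquiv.restrictScalars ℝ)).ne_zero
  have h1 : μ.map e = ENNReal.ofReal |(LinearMap.det f)⁻¹| • μ :=
    Measure.map_linearMap_addHaar_eq_smul_addHaar μ hdet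
  have : ProperSpace E := FiniteDimensional.proper ℂ E
  have h2 : μ.map e (ball 0 1) = μ (ball 0 1) := by
    rw [Measure.map_apply e.continuous.measurable measurableSet_ball, e.preimage_ball, map_zero]
  rw [h1] at h2 ⊢
  have h0 : μ (ball 0 1) ≠ 0 := (measure_ball_pos μ 0 one_pos).ne'
  have ht : μ (ball 0 1) ≠ ⊤ := measure_ball_lt_top.ne
  rw [Measure.smul_apply, smul_eq_mul, ENNReal.mul_eq_right h0 ht] at h2
  rw [h2, one_smul]

theorem setIntegral_ball_eq_smul_of_differentiableOn {F : Type*} [NormedAddCommGroup F]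
    [NormedSpace ℂ F] [CompleteSpace F] {f : E → F} {z : E} {r : ℝ}
    {U : Set E} (hU : closedBall z r ⊆ U) (hf : ∀ w ∈ U, DifferentiableAt ℂ f w) :
    ∫ w in closedBall z r, f w ∂μ = μ.real (closedBall z r) • f z := by
  have : ProperSpace E := FiniteDimensional.proper ℂ E
  set B := closedBall (0 : E) r with hB
  set G : E → F := fun v => f (z + v) with hG
  have hmem : ∀ v ∈ B, z + v ∈ U := fun v hv => hU (by simpa [hB] using hv)
  have hGd : ∀ v ∈ B, DifferentiableAt ℂ G v := fun v hv =>
    (hf _ (hmem v hv)).comp v (by fun_prop)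
  have htrans : ∫ w in closedBall z r, f w ∂μ = ∫ v in B, G v ∂μ := by
    have := (measurePreserving_add_left μ z).setIntegral_preimage_emb
      (measurableEmbedding_addLeft z) f (closedBall z r)
    rw [← this]
    congr 2
    ext v
    simp [hB]
  have hvol : μ.real (closedBall z r) = μ.real B := by
    rw [measureReal_def, Measure.addHaar_closedBall_center, measureReal_def]
  have hcirc : ∀ θ : ℝ, ‖circleMap 0 1 θ‖ = 1 := fun θ => by simp
  have hrotmem : ∀ θ : ℝ, ∀ v ∈ B, circleMap 0 1 θ • v ∈ B := fun θ v hv => by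
    rw [hB, mem_closedBall_zero_iff] at *
    rwa [norm_smul, hcirc, one_mul]
  have hrot : ∀ θ : ℝ, ∫ v in B, G (circleMap 0 1 θ • v) ∂μ = ∫ v in B, G v ∂μ := by
    intro θ
    let e : E ≃ₗᵢ[ℂ] E := LinearIsometryEquiv.mk
      (LinearEquiv.smulOfUnit (Units.mk0 (circleMap 0 1 θ) (by simp)))
      (fun v => by
        change ‖circleMap 0 1 θ • v‖ = ‖v‖
        rw [norm_smul, hcirc, one_mul])
    have he : ∀ v, e v = circleMap 0 1 θ • v := fun v => rfl
    have hmp : MeasurePreserving e μ μ :=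
      ⟨e.continuous.measurable, map_addHaar_linearIsometryEquiv μ e⟩
    have := hmp.setIntegral_preimage_emb e.toHomeomorph.measurableEmbedding G B
    rw [hB, e.preimage_closedBall, map_zero] at this
    simpa only [he] using this
  have hswap : ∫ θ in (0 : ℝ)..2 * Real.pi, ∫ v in B, G (circleMap 0 1 θ • v) ∂μ =
      ∫ v in B, (∫ θ in (0 : ℝ)..2 * Real.pi, G (circleMap 0 1 θ • v)) ∂μ := by
    simp only [intervalIntegral.integral_of_le Real.two_pi_pos.le]
    refine integral_integral_swap ?_
    have hc : ContinuousOn (fun p : ℝ × E => G (circleMap 0 1 p.1 • p.2))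
        (Icc 0 (2 * Real.pi) ×ˢ B) := by
      intro p hp
      have h1 : ContinuousAt G (circleMap 0 1 p.1 • p.2) :=
        (hGd _ (hrotmem _ _ hp.2)).continuousAt
      exact (ContinuousAt.comp (f := fun p : ℝ × E => circleMap 0 1 p.1 • p.2) h1
        (by fun_prop)).continuousWithinAt
    have hi := hc.integrableOn_compact (μ := (volume : Measure ℝ).prod μ)
      (isCompact_Icc.prod (isCompact_closedBall 0 r))
    rw [IntegrableOn, ← Measure.prod_restrict] at hi
    refine hi.mono_measure ?_
    gcongr
    exact Ioc_subset_Icc_self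
  have hmean : ∀ v ∈ B, ∫ θ in (0 : ℝ)..2 * Real.pi, G (circleMap 0 1 θ • v) =
      (2 * Real.pi) • G 0 := by
    intro v hv
    have hd : DiffContOnCl ℂ (fun t : ℂ => G (t • v)) (ball 0 |(1 : ℝ)|) := by
      have : ∀ t ∈ closedBall (0 : ℂ) 1, DifferentiableAt ℂ (fun t : ℂ => G (t • v)) t := by
        intro t ht
        refine DifferentiableAt.comp (g := G) t (hGd (t • v) ?_) (by fun_prop)
        rw [hB, mem_closedBall_zero_iff] at *
        rw [norm_smul]
        nlinarith [norm_nonneg v]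
      rw [abs_one]
      refine DifferentiableOn.diffContOnCl fun t ht => ?_
      rw [closure_ball _ one_ne_zero] at ht
      exact (this t ht).differentiableWithinAt
    have := hd.circleAverage
    rw [Real.circleAverage_def, zero_smul] at this
    rw [← this, smul_smul, mul_inv_cancel₀ Real.two_pi_pos.ne', one_smul]
  have hfin : (2 * Real.pi) • ∫ v in B, G v ∂μ = (2 * Real.pi) • (μ.real B • G 0) := by
    have h1 : ∫ θ in (0 : ℝ)..2 * Real.pi, ∫ v in B, G (circleMap 0 1 θ • v) ∂μ =
        (2 * Real.pi) • ∫ v in B, G v ∂μ := by simp [hrot]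
    have h2 : ∫ v in B, (∫ θ in (0 : ℝ)..2 * Real.pi, G (circleMap 0 1 θ • v)) ∂μ =
        ∫ v in B, (2 * Real.pi) • G 0 ∂μ :=
      setIntegral_congr_fun measurableSet_closedBall hmean
    rw [← h1, hswap, h2, setIntegral_const, smul_comm]
  rw [htrans, hvol, smul_right_injective F Real.two_pi_pos.ne' hfin]
  simp [hG]

/-- Point evaluations of holomorphic functions are bounded by `L²` norms, locally uniformly. -/
theorem norm_le_of_ae_eq_of_closedBall_subset {D : Set E} (hD : IsOpen D) {f : E → ℂ}
    (hf : DifferentiableOn ℂ f D) (g : Lp ℂ 2 (μ.restrict D)) (hfg : g =ᵐ[μ.restrict D] f)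
    {z : E} {r : ℝ} (hr : 0 < r) (hz : closedBall z r ⊆ D) :
    ‖f z‖ ≤ (μ.real (closedBall 0 r) ^ (1 / 2 : ℝ) / μ.real (closedBall 0 r)) * ‖g‖ := by
  have : ProperSpace E := FiniteDimensional.proper ℂ E
  have hm := setIntegral_ball_eq_smul_of_differentiableOn μ hz
    fun w hw => hf.differentiableAt (hD.mem_nhds hw)
  have hvol : μ.real (closedBall z r) = μ.real (closedBall 0 r) := by
    rw [measureReal_def, Measure.addHaar_closedBall_center, measureReal_def]
  have hpos : 0 < μ.real (closedBall (0 : E) r) :=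
    ENNReal.toReal_pos (measure_closedBall_pos μ 0 hr).ne' measure_closedBall_lt_top.ne
  have hres : (μ.restrict D).restrict (closedBall z r) = μ.restrict (closedBall z r) :=
    Measure.restrict_restrict_of_subset hz
  have hne : (μ.restrict D) (closedBall z r) ≠ ⊤ :=
    ((Measure.restrict_apply_le _ _).trans_lt measure_closedBall_lt_top).ne
  have hval : (μ.restrict D).real (closedBall z r) = μ.real (closedBall 0 r) := by
    rw [← hvol, measureReal_restrict_apply measurableSet_closedBall,
      inter_eq_self_of_subset_left hz]
  have hin := L2.inner_indicatorConstLp_one (𝕜 := ℂ) measurableSet_closedBall hne g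
  have hint : ∫ w in closedBall z r, g w ∂(μ.restrict D) = ∫ w in closedBall z r, f w ∂μ := by
    rw [← hres]
    exact integral_congr_ae (ae_restrict_of_ae hfg)
  rw [hint, hm] at hin
  have hle := norm_inner_le_norm (𝕜 := ℂ)
    (indicatorConstLp 2 measurableSet_closedBall hne (1 : ℂ)) g
  rw [hin, norm_indicatorConstLp (by norm_num) (by norm_num), hval, hvol, norm_smul,
    Real.norm_of_nonneg hpos.le] at hle
  rw [div_mul_eq_mul_div, le_div_iff₀ hpos]
  simpa [mul_comm] using hle

end MeanValue

/-! ## The Bergman space as a Hilbert space -/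

namespace Bergman

open Metric Set Filter Topology MeasureTheory

noncomputable section

variable {E : Type*} [NormedAddCommGroup E] [NormedSpace ℂ E]
  [MeasurableSpace E]

/-- The Bergman space of `D`, as a space of classes of square integrable functions. -/
def bergmanSpace (μ : Measure E) (D : Set E) : Submodule ℂ (Lp ℂ 2 (μ.restrict D)) where
  carrier := {g | ∃ f : E → ℂ, DifferentiableOn ℂ f D ∧ g =ᵐ[μ.restrict D] f}
  zero_mem' := ⟨0, differentiableOn_const 0, Lp.coeFn_zero _ _ _⟩
  add_mem' := by
    rintro a b ⟨f, hf, hfa⟩ ⟨g, hg, hgb⟩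
    exact ⟨f + g, hf.add hg, (Lp.coeFn_add a b).trans (hfa.add hgb)⟩
  smul_mem' := by
    rintro c a ⟨f, hf, hfa⟩
    exact ⟨c • f, hf.const_smul c, (Lp.coeFn_smul c a).trans (hfa.const_smul c)⟩

variable {μ : Measure E} {D : Set E}

/-- The holomorphic representative of an element of the Bergman space. -/
def holRep (g : bergmanSpace μ D) : E → ℂ := g.2.choose

theorem differentiableOn_holRep (g : bergmanSpace μ D) : DifferentiableOn ℂ (holRep g) D :=
  g.2.choose_spec.1

theorem coeFn_ae_eq_holRep (g : bergmanSpace μ D) :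
    (g : Lp ℂ 2 (μ.restrict D)) =ᵐ[μ.restrict D] holRep g :=
  g.2.choose_spec.2

/-- A square integrable holomorphic function as an element of the Bergman space. -/
def toBergmanSpace {f : E → ℂ} (hf : DifferentiableOn ℂ f D) (hf2 : MemLp f 2 (μ.restrict D)) :
    bergmanSpace μ D :=
  ⟨hf2.toLp f, f, hf, hf2.coeFn_toLp⟩

section

variable [μ.IsOpenPosMeasure]

theorem eqOn_holRep (hD : IsOpen D) (g : bergmanSpace μ D) {f : E → ℂ}
    (hf : DifferentiableOn ℂ f D)
    (hfg : (g : Lp ℂ 2 (μ.restrict D)) =ᵐ[μ.restrict D] f) : EqOn (holRep g) f D :=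
  Measure.eqOn_open_of_ae_eq ((coeFn_ae_eq_holRep g).symm.trans hfg) hD
    (differentiableOn_holRep g).continuousOn hf.continuousOn

theorem holRep_toBergmanSpace (hD : IsOpen D) {f : E → ℂ} (hf : DifferentiableOn ℂ f D)
    (hf2 : MemLp f 2 (μ.restrict D)) : EqOn (holRep (toBergmanSpace hf hf2)) f D :=
  eqOn_holRep hD _ hf hf2.coeFn_toLp

theorem holRep_add (hD : IsOpen D) (a b : bergmanSpace μ D) :
    EqOn (holRep (a + b)) (holRep a + holRep b) D :=
  eqOn_holRep hD _ ((differentiableOn_holRep a).add (differentiableOn_holRep b))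
    ((Lp.coeFn_add _ _).trans ((coeFn_ae_eq_holRep a).add (coeFn_ae_eq_holRep b)))

theorem holRep_smul (hD : IsOpen D) (c : ℂ) (a : bergmanSpace μ D) :
    EqOn (holRep (c • a)) (c • holRep a) D :=
  eqOn_holRep hD _ ((differentiableOn_holRep a).const_smul c)
    ((Lp.coeFn_smul _ _).trans ((coeFn_ae_eq_holRep a).const_smul c))

end

variable [BorelSpace E] [FiniteDimensional ℂ E] [μ.IsAddHaarMeasure]

theorem exists_ball_norm_holRep_le (hD : IsOpen D) {z : E} (hz : z ∈ D) :
    ∃ R > 0, ball z R ⊆ D ∧ ∃ C, ∀ g : bergmanSpace μ D, ∀ w ∈ ball z R,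
      ‖holRep g w‖ ≤ C * ‖g‖ := by
  obtain ⟨R, hR, h⟩ := Metric.isOpen_iff.1 hD z hz
  refine ⟨R / 2, by positivity, (ball_subset_ball (by linarith)).trans h,
    μ.real (closedBall 0 (R / 3)) ^ (1 / 2 : ℝ) / μ.real (closedBall 0 (R / 3)),
    fun g w hw => ?_⟩
  have hsub : closedBall w (R / 3) ⊆ D := by
    refine Subset.trans (fun y hy => ?_) h
    rw [mem_ball, mem_closedBall] at *
    linarith [dist_triangle y w z]
  exact norm_le_of_ae_eq_of_closedBall_subset μ hD (differentiableOn_holRep g) g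
    (coeFn_ae_eq_holRep g) (by positivity) hsub

/-- Evaluation at a point of `D`, on the Bergman space. -/
def evalAt (hD : IsOpen D) {z : E} (hz : z ∈ D) : StrongDual ℂ (bergmanSpace μ D) :=
  LinearMap.mkContinuousOfExistsBound
    { toFun := fun g => holRep g z
      map_add' := fun a b => holRep_add hD a b hz
      map_smul' := fun c a => holRep_smul hD c a hz }
    (by
      obtain ⟨R, hR, -, C, hC⟩ := exists_ball_norm_holRep_le (μ := μ) hD hz
      exact ⟨C, fun g => hC g z (mem_ball_self hR)⟩)

open Classical in
/-- Evaluation at points, as a map from `E` to the dual of the Bergman space. -/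
def evalMap (μ : Measure E) [μ.IsAddHaarMeasure] (hD : IsOpen D) (z : E) :
    StrongDual ℂ (bergmanSpace μ D) :=
  if hz : z ∈ D then evalAt hD hz else 0

theorem evalMap_apply (hD : IsOpen D) {z : E} (hz : z ∈ D) (g : bergmanSpace μ D) :
    evalMap μ hD z g = holRep g z := by
  rw [evalMap, dif_pos hz]
  rfl

theorem exists_norm_fderiv_holRep_le (hD : IsOpen D) {z : E} (hz : z ∈ D) :
    ∃ C, ∀ g : bergmanSpace μ D, ‖fderiv ℂ (holRep g) z‖ ≤ C * ‖g‖ := by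
  obtain ⟨R, hR, hRD, C, hC⟩ := exists_ball_norm_holRep_le (μ := μ) hD hz
  refine ⟨2 * C / R, fun g => ?_⟩
  refine (norm_fderiv_le_of_forall_ball_norm_le hR ((differentiableOn_holRep g).mono hRD)
    (hC g)).trans (le_of_eq (by ring))

/-- The derivative of the evaluation map at a point of `D`. -/
def evalDeriv (μ : Measure E) [μ.IsAddHaarMeasure] (hD : IsOpen D) {z : E} (hz : z ∈ D) :
    E →L[ℂ] StrongDual ℂ (bergmanSpace μ D) :=
  LinearMap.toContinuousLinearMap
    { toFun := fun h => LinearMap.mkContinuousOfExistsBound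
        { toFun := fun g => fderiv ℂ (holRep g) z h
          map_add' := fun a b => by
            rw [((holRep_add hD a b).eventuallyEq_of_mem (hD.mem_nhds hz)).fderiv_eq,
              fderiv_add ((differentiableOn_holRep a).differentiableAt (hD.mem_nhds hz))
              ((differentiableOn_holRep b).differentiableAt (hD.mem_nhds hz))]
            rfl
          map_smul' := fun c a => by
            rw [((holRep_smul hD c a).eventuallyEq_of_mem (hD.mem_nhds hz)).fderiv_eq,
              fderiv_const_smul ((differentiableOn_holRep a).differentiableAt (hD.mem_nhds hz))]
            rfl }
        (by
          obtain ⟨C, hC⟩ := exists_norm_fderiv_holRep_le (μ := μ) hD hz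
          refine ⟨C * ‖h‖, fun g => ?_⟩
          refine (ContinuousLinearMap.le_opNorm _ h).trans ?_
          calc _ ≤ C * ‖g‖ * ‖h‖ := by gcongr; exact hC g
            _ = C * ‖h‖ * ‖g‖ := by ring)
      map_add' := fun h h' => by
        ext g
        exact map_add (fderiv ℂ (holRep g) z) h h'
      map_smul' := fun c h => by
        ext g
        exact map_smul (fderiv ℂ (holRep g) z) c h }

theorem evalDeriv_apply (hD : IsOpen D) {z : E} (hz : z ∈ D) (h : E) (g : bergmanSpace μ D) :
    evalDeriv μ hD hz h g = fderiv ℂ (holRep g) z h := rfl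

theorem hasFDerivAt_evalMap (hD : IsOpen D) {z : E} (hz : z ∈ D) :
    HasFDerivAt (evalMap μ hD) (evalDeriv μ hD hz) z := by
  obtain ⟨R, hR, hRD, C, hC⟩ := exists_ball_norm_holRep_le (μ := μ) hD hz
  refine (hasFDerivAt_iff_isLittleO_nhds_zero (𝕜 := ℂ)
    (F := StrongDual ℂ (bergmanSpace μ D))).2 ?_
  have hb : ∀ h ∈ ball (0 : E) R, ‖evalMap μ hD (z + h) - evalMap μ hD z - evalDeriv μ hD hz h‖ ≤
      4 * |C| / R ^ 2 * ‖‖h‖ ^ 2‖ := by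
    intro h hh
    rw [mem_ball_zero_iff] at hh
    refine ContinuousLinearMap.opNorm_le_bound _ (by positivity) fun g => ?_
    have hzh : z + h ∈ D := hRD (by simpa using hh)
    have := norm_sub_sub_fderiv_le_of_forall_ball_norm_le (C := |C| * ‖g‖)
      ((differentiableOn_holRep g).mono hRD)
      (fun w hw => (hC g w hw).trans (by gcongr; exact le_abs_self C)) hh
    simp only [sub_apply]
    rw [evalMap_apply hD hzh, evalMap_apply hD hz, evalDeriv_apply]
    refine this.trans (le_of_eq ?_)
    rw [Real.norm_of_nonneg (by positivity)]
    ring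
  refine Asymptotics.IsBigO.trans_isLittleO (g := fun h : E => ‖h‖ ^ 2)
    (Asymptotics.IsBigO.of_bound _ (eventually_of_mem (ball_mem_nhds 0 hR) hb)) ?_
  exact Asymptotics.isLittleO_norm_pow_id one_lt_two

theorem differentiableOn_evalMap (hD : IsOpen D) : DifferentiableOn ℂ (evalMap μ hD) D :=
  fun _ hz => (hasFDerivAt_evalMap hD hz).differentiableAt.differentiableWithinAt

/-- A Cauchy sequence of vectors, paired with a holomorphic family of functionals, converges to
a holomorphic function. -/
theorem exists_differentiableOn_tendsto_dual {E G : Type*}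
    [NormedAddCommGroup E] [NormedSpace ℂ E] [NormedAddCommGroup G] [NormedSpace ℂ G]
    {D : Set E} {e : E → StrongDual ℂ G} (he : DifferentiableOn ℂ e D) {v : ℕ → G} (hv : CauchySeq v) :
    ∃ φ : E → ℂ, DifferentiableOn ℂ φ D ∧ ∀ z, Tendsto (fun n => e z (v n)) atTop (𝓝 (φ z)) := by
  obtain ⟨Λ, hΛ⟩ := cauchySeq_tendsto_of_complete
    ((NormedSpace.inclusionInDoubleDualLi ℂ (E := G)).isometry.uniformContinuous.comp_cauchySeq hv)
  exact ⟨fun z => Λ (e z), Λ.differentiable.comp_differentiableOn he, fun z =>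
    ((ContinuousLinearMap.apply ℂ ℂ (e z)).continuous.tendsto Λ).comp hΛ⟩

theorem isClosed_bergmanSpace (hD : IsOpen D) :
    IsClosed (bergmanSpace μ D : Set (Lp ℂ 2 (μ.restrict D))) := by
  refine isClosed_of_closure_subset fun g hg => ?_
  obtain ⟨u, hu, hug⟩ := mem_closure_iff_seq_limit.1 hg
  let v : ℕ → bergmanSpace μ D := fun n => ⟨u n, hu n⟩
  have hv : CauchySeq v := by
    have : CauchySeq (fun n => (v n : Lp ℂ 2 (μ.restrict D))) := hug.cauchySeq
    rw [CauchySeq] at this ⊢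
    rwa [← isUniformInducing_val _ |>.cauchy_map_iff, map_map]
  obtain ⟨φ, hφ, hlim⟩ := exists_differentiableOn_tendsto_dual
    (differentiableOn_evalMap (μ := μ) hD) hv
  refine ⟨φ, hφ, ?_⟩
  obtain ⟨ns, hns, hae⟩ := (tendstoInMeasure_of_tendsto_Lp hug).exists_seq_tendsto_ae
  have hrep : ∀ᵐ z ∂(μ.restrict D), ∀ n, u n z = holRep (v n) z :=
    ae_all_iff.2 fun n => coeFn_ae_eq_holRep (v n)
  filter_upwards [hae, hrep, ae_restrict_mem hD.measurableSet] with z h1 h2 h3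
  simp only [h2] at h1
  refine tendsto_nhds_unique h1 (((hlim z).comp hns.tendsto_atTop).congr fun n => ?_)
  exact evalMap_apply hD h3 (v (ns n))

theorem completeSpace_bergmanSpace (hD : IsOpen D) : CompleteSpace (bergmanSpace μ D) :=
  (isClosed_bergmanSpace hD).completeSpace_coe

/-- The Riesz representative of the evaluation at `z`. -/
def repr (μ : Measure E) [μ.IsAddHaarMeasure] (hD : IsOpen D) (z : E) : bergmanSpace μ D :=
  haveI : CompleteSpace (bergmanSpace μ D) := completeSpace_bergmanSpace hD
  (InnerProductSpace.toDual ℂ (bergmanSpace μ D)).symm (evalMap μ hD z)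

theorem inner_repr (hD : IsOpen D) {z : E} (hz : z ∈ D) (g : bergmanSpace μ D) :
    inner ℂ (repr μ hD z) g = holRep g z := by
  have : CompleteSpace (bergmanSpace μ D) := completeSpace_bergmanSpace hD
  rw [repr, InnerProductSpace.toDual_symm_apply, evalMap_apply hD hz]

/-- The conjugate-linear Riesz isometry, as a real linear map. -/
def rieszCLM (H : Type*) [NormedAddCommGroup H] [InnerProductSpace ℂ H] [CompleteSpace H] :
    StrongDual ℂ H →L[ℝ] H where
  toFun := (InnerProductSpace.toDual ℂ H).symm
  map_add' := map_add _
  map_smul' c x := by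
    have := (InnerProductSpace.toDual ℂ H).symm.map_smulₛₗ (c : ℂ) x
    simpa using this
  cont := (InnerProductSpace.toDual ℂ H).symm.continuous

theorem rieszCLM_smul {H : Type*} [NormedAddCommGroup H] [InnerProductSpace ℂ H] [CompleteSpace H]
    (c : ℂ) (x : StrongDual ℂ H) : rieszCLM H (c • x) = star c • rieszCLM H x :=
  (InnerProductSpace.toDual ℂ H).symm.map_smulₛₗ c x

theorem inner_rieszCLM {H : Type*} [NormedAddCommGroup H] [InnerProductSpace ℂ H] [CompleteSpace H]
    (x : StrongDual ℂ H) (g : H) : inner ℂ (rieszCLM H x) g = x g :=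
  InnerProductSpace.toDual_symm_apply

end

end Bergman

/-! ## The Bergman metric dominates the Carathéodory metric -/

namespace Bergman

open Metric Set Filter Topology MeasureTheory

noncomputable section

theorem iteratedFDeriv_two_apply_self_eq {E : Type*} [NormedAddCommGroup E] [NormedSpace ℝ E]
    {u : E → ℝ} {p : E} (hu : ContDiffAt ℝ 2 u p) (X : E) :
    iteratedFDeriv ℝ 2 u p ![X, X] = deriv (deriv fun t : ℝ => u (p + t • X)) 0 := by
  have hl : ∀ t : ℝ, HasDerivAt (fun t : ℝ => p + t • X) X t := fun t => by
    simpa using ((hasDerivAt_id t).smul_const X).const_add p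
  have hlc : Tendsto (fun t : ℝ => p + t • X) (𝓝 0) (𝓝 p) := by
    have : ContinuousAt (fun t : ℝ => p + t • X) 0 := (hl 0).continuousAt
    simpa [ContinuousAt] using this
  have h1 : (deriv fun t : ℝ => u (p + t • X)) =ᶠ[𝓝 0] fun t => fderiv ℝ u (p + t • X) X := by
    have h2 : ∀ᶠ z in 𝓝 p, DifferentiableAt ℝ u z :=
      (hu.eventually (by simp)).mono fun z hz => hz.differentiableAt (by norm_num)
    filter_upwards [hlc.eventually h2] with t ht
    exact (ht.hasFDerivAt.comp_hasDerivAt t (hl t)).deriv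
  rw [iteratedFDeriv_two_apply, h1.deriv_eq]
  have h3 : DifferentiableAt ℝ (fderiv ℝ u) (p + (0 : ℝ) • X) := by
    rw [zero_smul, add_zero]
    exact (hu.fderiv_right (m := 1) (by norm_num)).differentiableAt (by norm_num)
  have h4 : HasDerivAt (fun t : ℝ => fderiv ℝ u (p + t • X))
      (fderiv ℝ (fderiv ℝ u) (p + (0 : ℝ) • X) X) 0 :=
    HasFDerivAt.comp_hasDerivAt (l := fderiv ℝ u) (0 : ℝ) h3.hasFDerivAt (hl 0)
  have h5 : HasDerivAt (fun t : ℝ => fderiv ℝ u (p + t • X) X)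
      (fderiv ℝ (fderiv ℝ u) (p + (0 : ℝ) • X) X X) 0 :=
    (ContinuousLinearMap.apply ℝ ℝ X).hasFDerivAt.comp_hasDerivAt (0 : ℝ) h4
  rw [h5.deriv, zero_smul, add_zero]
  rfl

section Curve

variable {H : Type*} [NormedAddCommGroup H] [InnerProductSpace ℂ H]

theorem hasDerivAt_re_inner {f g : ℝ → H} {f' g' : H} {t : ℝ} (hf : HasDerivAt f f' t)
    (hg : HasDerivAt g g' t) : HasDerivAt (fun s => (inner ℂ (f s) (g s)).re)
      ((inner ℂ (f t) g').re + (inner ℂ f' (g t)).re) t := by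
  have h : HasDerivAt (fun s => inner ℂ (f s) (g s)) _ t := hf.inner ℂ hg
  exact (Complex.reCLM.hasFDerivAt (x := inner ℂ (f t) (g t))).comp_hasDerivAt t h

/-- The second derivative of `log ‖κ‖²` along a curve in a Hilbert space. -/
theorem deriv_deriv_log_norm_sq {κ κ₁ : ℝ → H} {c : H}
    (hκ : ∀ᶠ t in 𝓝 0, HasDerivAt κ (κ₁ t) t) (hκ₁ : HasDerivAt κ₁ c 0) (h0 : κ 0 ≠ 0) :
    deriv (deriv fun t => Real.log (‖κ t‖ ^ 2)) 0 =
      (2 * ‖κ₁ 0‖ ^ 2 + 2 * (inner ℂ (κ 0) c).re) / ‖κ 0‖ ^ 2 -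
        (2 * (inner ℂ (κ 0) (κ₁ 0)).re) ^ 2 / (‖κ 0‖ ^ 2) ^ 2 := by
  have hN : ∀ v : H, ‖v‖ ^ 2 = (inner ℂ v v).re := fun v => by
    rw [inner_self_eq_norm_sq_to_K]
    norm_cast
  have hsymm : ∀ v w : H, (inner ℂ v w).re = (inner ℂ w v).re := fun v w =>
    inner_re_symm (𝕜 := ℂ) v w
  have hκ0 := hκ.self_of_nhds
  have hne : ∀ᶠ t in 𝓝 0, κ t ≠ 0 := hκ0.continuousAt.eventually_ne h0
  have hd1 : ∀ t, HasDerivAt κ (κ₁ t) t →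
      HasDerivAt (fun t => ‖κ t‖ ^ 2) (2 * (inner ℂ (κ t) (κ₁ t)).re) t := fun t ht => by
    have := hasDerivAt_re_inner ht ht
    simp only [hN]
    rw [two_mul]
    nth_rewrite 2 [hsymm]
    exact this
  have h1 : (deriv fun t => Real.log (‖κ t‖ ^ 2)) =ᶠ[𝓝 0]
      fun t => 2 * (inner ℂ (κ t) (κ₁ t)).re / ‖κ t‖ ^ 2 := by
    filter_upwards [hκ, hne] with t ht hne
    exact ((hd1 t ht).log (pow_ne_zero 2 (norm_ne_zero_iff.2 hne))).deriv
  rw [h1.deriv_eq]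
  have hn : ‖κ 0‖ ^ 2 ≠ 0 := pow_ne_zero 2 (norm_ne_zero_iff.2 h0)
  have h2 := ((hasDerivAt_re_inner hκ0 hκ₁).const_mul 2).div (hd1 0 hκ0) hn
  refine h2.deriv.trans ?_
  rw [← hN]
  field_simp
  ring

/-- If `f` is orthogonal to `a`, the component of `b` orthogonal to `a` controls `⟪b, f⟫`. -/
theorem norm_inner_sq_le_of_inner_eq_zero {a b g : H} (ha : a ≠ 0) (hg : inner ℂ a g = 0) :
    ‖inner ℂ b g‖ ^ 2 ≤ (‖b‖ ^ 2 - ‖inner ℂ a b‖ ^ 2 / ‖a‖ ^ 2) * ‖g‖ ^ 2 := by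
  have hn : (‖a‖ : ℝ) ≠ 0 := norm_ne_zero_iff.2 ha
  set s : ℂ := inner ℂ a b / (‖a‖ : ℂ) ^ 2 with hs
  have haa : inner ℂ a a = (‖a‖ : ℂ) ^ 2 := inner_self_eq_norm_sq_to_K a
  have hc : (‖a‖ : ℂ) ≠ 0 := by exact_mod_cast hn
  have h1 : inner ℂ (b - s • a) g = inner ℂ b g := by
    rw [inner_sub_left, inner_smul_left, hg, mul_zero, sub_zero]
  have h3 : inner ℂ a (b - s • a) = 0 := by
    rw [inner_sub_right, inner_smul_right, haa, hs]
    field_simp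
    ring
  have h2 : ‖b‖ ^ 2 = ‖b - s • a‖ ^ 2 + ‖s • a‖ ^ 2 := by
    have := norm_add_sq_eq_norm_sq_add_norm_sq_of_inner_eq_zero (𝕜 := ℂ) (b - s • a) (s • a)
      (by rw [inner_smul_right, ← inner_conj_symm, h3]; simp)
    rw [sub_add_cancel] at this
    simpa [sq] using this
  have h4 : ‖s • a‖ ^ 2 = ‖inner ℂ a b‖ ^ 2 / ‖a‖ ^ 2 := by
    rw [norm_smul, hs, norm_div, norm_pow, Complex.norm_real, norm_norm]
    field_simp
  rw [h2, h4, add_sub_cancel_right, ← h1, ← mul_pow]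
  gcongr
  exact norm_inner_le_norm _ _

end Curve

variable {E : Type*} [NormedAddCommGroup E] [NormedSpace ℂ E] [FiniteDimensional ℂ E]

/-- The Levi form of `log ‖k‖²`, for `k` conjugate to a holomorphic map `e`. -/
theorem leviForm_log_norm_sq {H : Type*} [NormedAddCommGroup H] [InnerProductSpace ℂ H]
    [CompleteSpace H] {D : Set E} (hD : IsOpen D) {e : E → StrongDual ℂ H}
    (he : DifferentiableOn ℂ e D) {p : E} (hp : p ∈ D) (h0 : e p ≠ 0) (X : E) :
    leviForm (fun z => Real.log (‖rieszCLM H (e z)‖ ^ 2)) p X =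
      ‖rieszCLM H (fderiv ℂ e p X)‖ ^ 2 / ‖rieszCLM H (e p)‖ ^ 2 -
        ‖inner ℂ (rieszCLM H (e p)) (rieszCLM H (fderiv ℂ e p X))‖ ^ 2 /
          (‖rieszCLM H (e p)‖ ^ 2) ^ 2 := by
  have hk0 : rieszCLM H (e p) ≠ 0 :=
    (map_ne_zero_iff _ (InnerProductSpace.toDual ℂ H).symm.injective).2 h0
  have heC : ContDiffAt ℝ 2 e p :=
    ((DifferentiableOn.contDiffOn_complex hD 2 he).contDiffAt (hD.mem_nhds hp)).restrict_scalars ℝ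
  have hkC : ContDiffAt ℝ 2 (fun z => rieszCLM H (e z)) p :=
    (rieszCLM H).contDiff.contDiffAt.comp p heC
  have hu : ContDiffAt ℝ 2 (fun z => Real.log (‖rieszCLM H (e z)‖ ^ 2)) p :=
    (hkC.norm_sq ℂ).log (pow_ne_zero 2 (norm_ne_zero_iff.2 hk0))
  have heX := differentiableOn_fderiv_apply_complex hD he X
  have hlc : ∀ Y : E, ContinuousAt (fun t : ℝ => p + t • Y) 0 := fun Y => by fun_prop
  have hl : ∀ (Y : E) (t : ℝ), HasDerivAt (fun t : ℝ => p + t • Y) Y t := fun Y t => by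
    simpa using ((hasDerivAt_id t).smul_const Y).const_add p
  have hcurve : ∀ (f : E → StrongDual ℂ H), DifferentiableOn ℂ f D → ∀ (Y : E) (t : ℝ),
      p + t • Y ∈ D → HasDerivAt (fun t : ℝ => f (p + t • Y)) (fderiv ℂ f (p + t • Y) Y) t :=
    fun f hf Y t ht => by
      have h : HasFDerivAt f ((fderiv ℂ f (p + t • Y)).restrictScalars ℝ) (p + t • Y) :=
        (hf.differentiableAt (hD.mem_nhds ht)).hasFDerivAt.restrictScalars ℝ
      exact h.comp_hasDerivAt t (hl Y t)
  have hmain : ∀ c : ℂ, deriv (deriv fun t : ℝ =>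
      Real.log (‖rieszCLM H (e (p + t • (c • X)))‖ ^ 2)) 0 =
      (2 * ‖rieszCLM H (c • fderiv ℂ e p X)‖ ^ 2 +
        2 * (inner ℂ (rieszCLM H (e p)) (rieszCLM H (c • c •
          fderiv ℂ (fun z => fderiv ℂ e z X) p X))).re) / ‖rieszCLM H (e p)‖ ^ 2 -
        (2 * (inner ℂ (rieszCLM H (e p)) (rieszCLM H (c • fderiv ℂ e p X))).re) ^ 2 /
          (‖rieszCLM H (e p)‖ ^ 2) ^ 2 := by
    intro c
    have hmem : ∀ᶠ t : ℝ in 𝓝 0, p + t • (c • X) ∈ D :=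
      (hlc (c • X)).eventually_mem (by simpa using hD.mem_nhds hp)
    have := deriv_deriv_log_norm_sq (κ := fun t => rieszCLM H (e (p + t • (c • X))))
      (κ₁ := fun t => rieszCLM H (c • fderiv ℂ e (p + t • (c • X)) X))
      (c := rieszCLM H (c • c • fderiv ℂ (fun z => fderiv ℂ e z X) p X)) ?_ ?_ (by simpa using hk0)
    · simpa using this
    · filter_upwards [hmem] with t ht
      have := (rieszCLM H).hasFDerivAt.comp_hasDerivAt t (hcurve e he (c • X) t ht)
      rw [map_smul] at this
      exact this
    · have h := hcurve _ heX (c • X) 0 hmem.self_of_nhds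
      rw [zero_smul, add_zero, map_smul] at h
      exact (rieszCLM H).hasFDerivAt.comp_hasDerivAt 0 (h.const_smul c)
  rw [leviForm, iteratedFDeriv_two_apply_self_eq hu, iteratedFDeriv_two_apply_self_eq hu,
    hmain Complex.I]
  have h1 := hmain 1
  simp only [one_smul] at h1
  rw [h1]
  have hn : ‖rieszCLM H (e p)‖ ≠ 0 := norm_ne_zero_iff.2 hk0
  simp only [rieszCLM_smul, smul_smul, norm_smul, inner_smul_right, Complex.sq_norm,
    Complex.normSq_apply, Complex.I_mul_I, Complex.star_def,
    Complex.conj_I, map_neg, map_one, Complex.neg_re, one_mul, norm_neg, Complex.norm_I,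
    Complex.I_mul_re, neg_mul]
  field_simp
  ring

variable [MeasurableSpace E] [BorelSpace E] {μ : Measure E} [μ.IsAddHaarMeasure] {D : Set E}

/-- The Levi form of `log K(z, z)` dominates the squared derivatives of holomorphic functions
with values in the unit disk. -/
theorem norm_fderiv_sq_le_leviForm (hD : IsOpen D) {p : E} (hp : p ∈ D)
    (h0 : repr μ hD p ≠ 0) {F : E → ℂ} (hF : DifferentiableOn ℂ F D)
    (hF1 : ∀ z ∈ D, ‖F z‖ ≤ 1) (hFp : F p = 0) (X : E) :
    ‖fderiv ℂ F p X‖ ^ 2 ≤ leviForm (fun z => Real.log (‖repr μ hD z‖ ^ 2)) p X := by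
  have hc : CompleteSpace (bergmanSpace μ D) := completeSpace_bergmanSpace hD
  have h0' : evalMap μ hD p ≠ 0 := fun h => h0 (by
    rw [repr, h]
    exact (rieszCLM (bergmanSpace μ D)).map_zero)
  have hlevi := leviForm_log_norm_sq hD (differentiableOn_evalMap (μ := μ) hD) hp h0' X
  refine le_of_le_of_eq ?_ hlevi.symm
  set a := repr μ hD p with ha
  set b := rieszCLM (bergmanSpace μ D) (fderiv ℂ (evalMap μ hD) p X) with hb
  change _ ≤ ‖b‖ ^ 2 / ‖a‖ ^ 2 - ‖inner ℂ a b‖ ^ 2 / (‖a‖ ^ 2) ^ 2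
  have hmul : DifferentiableOn ℂ (fun z => F z * holRep a z) D :=
    hF.mul (differentiableOn_holRep a)
  have hle : ∀ᵐ z ∂(μ.restrict D), ‖F z * holRep a z‖ ≤ ‖(a : Lp ℂ 2 (μ.restrict D)) z‖ := by
    filter_upwards [coeFn_ae_eq_holRep a, ae_restrict_mem hD.measurableSet] with z hz hzD
    rw [hz, norm_mul]
    exact mul_le_of_le_one_left (norm_nonneg _) (hF1 z hzD)
  have hL2 : MemLp (fun z => F z * holRep a z) 2 (μ.restrict D) :=
    (Lp.memLp (a : Lp ℂ 2 (μ.restrict D))).of_le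
      (hmul.continuousOn.aestronglyMeasurable hD.measurableSet) hle
  set g : bergmanSpace μ D := toBergmanSpace hmul hL2 with hg
  have hgrep : EqOn (holRep g) (fun z => F z * holRep a z) D := holRep_toBergmanSpace hD hmul hL2
  have hgn : ‖g‖ ≤ ‖a‖ := by
    refine Lp.norm_le_norm_of_ae_le (f := (g : Lp ℂ 2 (μ.restrict D))) ?_
    filter_upwards [hle, hL2.coeFn_toLp] with z hz hz'
    change ‖(hL2.toLp _ : E → ℂ) z‖ ≤ _
    rw [hz']
    exact hz
  have hag : inner ℂ a g = 0 := by
    rw [ha, inner_repr hD hp, hgrep hp]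
    simp [hFp]
  have haa : holRep a p = (‖a‖ : ℂ) ^ 2 := by
    rw [← inner_repr (μ := μ) hD hp a, ← ha]
    exact inner_self_eq_norm_sq_to_K a
  have hbg : inner ℂ b g = fderiv ℂ F p X * (‖a‖ : ℂ) ^ 2 := by
    rw [hb, inner_rieszCLM, (hasFDerivAt_evalMap hD hp).fderiv, evalDeriv_apply,
      (hgrep.eventuallyEq_of_mem (hD.mem_nhds hp)).fderiv_eq,
      fderiv_fun_mul (hF.differentiableAt (hD.mem_nhds hp))
        ((differentiableOn_holRep a).differentiableAt (hD.mem_nhds hp)), ← haa]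
    simp [hFp, mul_comm]
  have hkey := norm_inner_sq_le_of_inner_eq_zero (b := b) h0 hag
  have hn : 0 < ‖a‖ ^ 2 := pow_pos (norm_pos_iff.2 h0) 2
  have hnn : 0 ≤ ‖b‖ ^ 2 - ‖inner ℂ a b‖ ^ 2 / ‖a‖ ^ 2 := by
    rw [sub_nonneg, div_le_iff₀ hn, ← mul_pow, mul_comm]
    gcongr
    exact norm_inner_le_norm a b
  have hfin : ‖fderiv ℂ F p X‖ ^ 2 * (‖a‖ ^ 2) ^ 2 ≤
      (‖b‖ ^ 2 - ‖inner ℂ a b‖ ^ 2 / ‖a‖ ^ 2) * ‖a‖ ^ 2 := by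
    calc _ = ‖inner ℂ b g‖ ^ 2 := by
          rw [hbg, norm_mul, norm_pow, Complex.norm_real, norm_norm]; ring
      _ ≤ _ := hkey
      _ ≤ _ := by gcongr
  have h2 : ‖b‖ ^ 2 / ‖a‖ ^ 2 - ‖inner ℂ a b‖ ^ 2 / (‖a‖ ^ 2) ^ 2 =
      (‖b‖ ^ 2 - ‖inner ℂ a b‖ ^ 2 / ‖a‖ ^ 2) * ‖a‖ ^ 2 / (‖a‖ ^ 2) ^ 2 := by
    field_simp
  rw [h2, le_div_iff₀ (by positivity)]
  exact hfin

end

section Kernel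

variable {E : Type*} [NormedAddCommGroup E] [NormedSpace ℂ E] [FiniteDimensional ℂ E] {D : Set E}

theorem isBergmanKernel_repr [MeasurableSpace E] [BorelSpace E] {μ : Measure E}
    [μ.IsAddHaarMeasure] (hD : IsOpen D) {w : E} (hw : w ∈ D) :
    (DifferentiableOn ℂ (fun z => holRep (repr μ hD w) z) D ∧
      MemLp (fun z => holRep (repr μ hD w) z) 2 (μ.restrict D)) ∧
    ∀ f : E → ℂ, DifferentiableOn ℂ f D ∧ MemLp f 2 (μ.restrict D) →
      f w = ∫ z in D, f z * star (holRep (repr μ hD w) z) ∂μ := by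
  refine ⟨⟨differentiableOn_holRep _, ?_⟩, fun f hf => ?_⟩
  · exact (memLp_congr_ae (coeFn_ae_eq_holRep (repr μ hD w))).1 (Lp.memLp _)
  · have h1 := inner_repr hD hw (toBergmanSpace hf.1 hf.2)
    rw [holRep_toBergmanSpace hD hf.1 hf.2 hw] at h1
    rw [← h1]
    refine (L2.inner_def (𝕜 := ℂ) (repr μ hD w : Lp ℂ 2 (μ.restrict D))
      (hf.2.toLp f)).trans (integral_congr_ae ?_)
    filter_upwards [coeFn_ae_eq_holRep (repr μ hD w), hf.2.coeFn_toLp] with z h2 h3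
    rw [h2, h3]
    rfl

/-- Every open set in a finite-dimensional complex space has a Bergman kernel. -/
theorem exists_isBergmanKernel (hD : IsOpen D) : ∃ K : E → E → ℂ, IsBergmanKernel D K := by
  let : MeasurableSpace E := borel E
  have : BorelSpace E := ⟨rfl⟩
  have : ProperSpace E := FiniteDimensional.proper ℂ E
  have : (lebesgue E).IsAddHaarMeasure := by
    unfold lebesgue
    infer_instance
  exact ⟨fun z w => holRep (repr (lebesgue E) hD w) z, fun w hw =>
    isBergmanKernel_repr (μ := lebesgue E) hD hw⟩

/-- The Bergman metric dominates the Carathéodory metric. -/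
theorem norm_fderiv_sq_le_metric (hD : IsOpen D) {p : E} (hp : p ∈ D)
    (h0 : ∃ f : E → ℂ, MemBergmanSpace D f ∧ f p ≠ 0) {F : E → ℂ} (hF : DifferentiableOn ℂ F D)
    (hF1 : ∀ z ∈ D, ‖F z‖ ≤ 1) (hFp : F p = 0) (X : E) :
    ‖fderiv ℂ F p X‖ ^ 2 ≤ metric D p X := by
  let : MeasurableSpace E := borel E
  have : BorelSpace E := ⟨rfl⟩
  have : ProperSpace E := FiniteDimensional.proper ℂ E
  have : (lebesgue E).IsAddHaarMeasure := by
    unfold lebesgue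
    infer_instance
  have hK : IsBergmanKernel D fun z w => holRep (repr (lebesgue E) hD w) z := fun w hw =>
    isBergmanKernel_repr (μ := lebesgue E) hD hw
  have hKK : ∀ z ∈ D, kernel D z z = (‖repr (lebesgue E) hD z‖ : ℂ) ^ 2 := fun z hz => by
    rw [IsBergmanKernel.eq_on (isBergmanKernel_kernel ⟨_, hK⟩) hK hz hz,
      ← inner_repr (μ := lebesgue E) hD hz]
    exact inner_self_eq_norm_sq_to_K (𝕜 := ℂ) (repr (lebesgue E) hD z)
  have hne : repr (lebesgue E) hD p ≠ 0 := by
    obtain ⟨f, hf, hfp⟩ := h0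
    intro h
    apply hfp
    rw [← holRep_toBergmanSpace (μ := lebesgue E) hD hf.1 hf.2 hp,
      ← inner_repr (μ := lebesgue E) hD hp, h, inner_zero_left]
  refine (norm_fderiv_sq_le_leviForm hD hp hne hF hF1 hFp X).trans (le_of_eq ?_)
  have heq : (fun z => Real.log (‖repr (lebesgue E) hD z‖ ^ 2)) =ᶠ[𝓝 p]
      fun z => Real.log (kernel D z z).re := by
    filter_upwards [hD.mem_nhds hp] with z hz
    rw [hKK z hz]
    norm_cast
  rw [metric, leviForm, leviForm, (heq.iteratedFDeriv ℝ 2).self_of_nhds]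

end Kernel

end Bergman

/-! ## Affine invariance and non-degeneracy of the Bergman kernel -/

namespace Bergman

open Metric Set Filter Topology MeasureTheory

theorem kernel_re_pos {E : Type*} [NormedAddCommGroup E] [NormedSpace ℂ E] [FiniteDimensional ℂ E]
    {D : Set E} (hD : IsOpen D) {p : E} (hp : p ∈ D)
    (h0 : ∃ f : E → ℂ, MemBergmanSpace D f ∧ f p ≠ 0) : 0 < (kernel D p p).re := by
  let : MeasurableSpace E := borel E
  have hK := isBergmanKernel_kernel (exists_isBergmanKernel hD)
  obtain ⟨hmem, hrep⟩ := hK p hp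
  have hself := hrep _ hmem
  have hsq : ∀ z, kernel D z p * star (kernel D z p) = ((‖kernel D z p‖ ^ 2 : ℝ) : ℂ) := fun z => by
    rw [Complex.star_def, Complex.mul_conj']
    norm_cast
  simp only [hsq] at hself
  rw [integral_complex_ofReal] at hself
  have hnn : 0 ≤ ∫ z in D, ‖kernel D z p‖ ^ 2 ∂(lebesgue E) :=
    integral_nonneg fun z => by positivity
  rw [hself, Complex.ofReal_re]
  refine lt_of_le_of_ne hnn fun h => ?_
  have hint : Integrable (fun z => ‖kernel D z p‖ ^ 2) ((lebesgue E).restrict D) :=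
    (memLp_two_iff_integrable_sq_norm hmem.2.1).1 hmem.2
  have hae := (integral_eq_zero_iff_of_nonneg (fun z => by positivity) hint).1 h.symm
  obtain ⟨f, hf, hfp⟩ := h0
  apply hfp
  rw [hrep f hf]
  refine integral_eq_zero_of_ae ?_
  filter_upwards [hae] with z hz
  exact mul_eq_zero_of_right _ (by simpa using hz)

section Affine

variable {E : Type*} [NormedAddCommGroup E] [NormedSpace ℂ E] [FiniteDimensional ℂ E] {D : Set E}

theorem exists_map_restrict_eq_smul [MeasurableSpace E] [BorelSpace E] (μ : Measure E)
    [μ.IsAddHaarMeasure] (hD : IsOpen D) (L : E ≃L[ℂ] E) (c : E)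
    (hT : ∀ z, L z + c ∈ D ↔ z ∈ D) : ∃ s : ℝ≥0, s ≠ 0 ∧
      (μ.restrict D).map (fun z => L z + c) = s • μ.restrict D := by
  have : FiniteDimensional ℝ E := FiniteDimensional.complexToReal E
  set f : E →ₗ[ℝ] E := ((L.toLinearEquiv.restrictScalars ℝ : E ≃ₗ[ℝ] E) : E →ₗ[ℝ] E)
  have hdet : LinearMap.det f ≠ 0 :=
    (LinearEquiv.isUnit_det' (L.toLinearEquiv.restrictScalars ℝ)).ne_zero
  have h1 : μ.map L = ENNReal.ofReal |(LinearMap.det f)⁻¹| • μ :=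
    Measure.map_linearMap_addHaar_eq_smul_addHaar μ hdet
  have hTm : Measurable fun z => L z + c := by fun_prop
  have h2 : μ.map (fun z => L z + c) = ENNReal.ofReal |(LinearMap.det f)⁻¹| • μ := by
    have h3 : (fun z => L z + c) = (fun z => z + c) ∘ L := rfl
    rw [h3, ← Measure.map_map (by fun_prop) (by fun_prop), h1, Measure.map_smul,
      (measurePreserving_add_right μ c).map_eq]
  refine ⟨Real.toNNReal |(LinearMap.det f)⁻¹|, ?_, ?_⟩
  · rw [Ne, Real.toNNReal_eq_zero, not_le]
    positivity
  · have hpre : (fun z => L z + c) ⁻¹' D = D := ext hT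
    have h4 := Measure.restrict_map (μ := μ) hTm hD.measurableSet
    rw [hpre, h2, Measure.restrict_smul] at h4
    exact h4.symm

theorem memBergmanSpace_comp_affine (hD : IsOpen D) (L : E ≃L[ℂ] E) (c : E)
    (hT : ∀ z, L z + c ∈ D ↔ z ∈ D) {f : E → ℂ} (hf : MemBergmanSpace D f) :
    MemBergmanSpace D fun z => f (L z + c) := by
  let : MeasurableSpace E := borel E
  have : BorelSpace E := ⟨rfl⟩
  have : ProperSpace E := FiniteDimensional.proper ℂ E
  have : (lebesgue E).IsAddHaarMeasure := by
    unfold lebesgue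
    infer_instance
  refine ⟨hf.1.comp (by fun_prop) fun z hz => (hT z).2 hz, ?_⟩
  obtain ⟨s, -, hs⟩ := exists_map_restrict_eq_smul (lebesgue E) hD L c hT
  refine MemLp.comp_of_map (g := f) (f := fun z => L z + c) ?_
    (Measurable.aemeasurable (by fun_prop))
  rw [hs]
  exact hf.2.smul_measure ENNReal.coe_ne_top

theorem kernel_affine (hD : IsOpen D) (L : E ≃L[ℂ] E) (c : E)
    (hT : ∀ z, L z + c ∈ D ↔ z ∈ D) : ∃ κ : ℝ, 0 < κ ∧ ∀ z ∈ D,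
      kernel D z z = κ * kernel D (L z + c) (L z + c) := by
  let : MeasurableSpace E := borel E
  have : BorelSpace E := ⟨rfl⟩
  have : ProperSpace E := FiniteDimensional.proper ℂ E
  have : (lebesgue E).IsAddHaarMeasure := by
    unfold lebesgue
    infer_instance
  obtain ⟨s, hs0, hs⟩ := exists_map_restrict_eq_smul (lebesgue E) hD L c hT
  have hK := isBergmanKernel_kernel (exists_isBergmanKernel hD)
  have hκ : (0 : ℝ) < (s : ℝ)⁻¹ := by positivity
  have hT' : ∀ z, L.symm z + -L.symm c ∈ D ↔ z ∈ D := fun z => by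
    rw [← hT]
    simp
  have hemb : MeasurableEmbedding fun z => L z + c :=
    (L.toHomeomorph.trans (Homeomorph.addRight c)).measurableEmbedding
  have hint : ∀ h : E → ℂ, ∫ z in D, h z ∂(lebesgue E) =
      ((s : ℝ)⁻¹ : ℝ) * ∫ z in D, h (L z + c) ∂(lebesgue E) := by
    intro h
    rw [← hemb.integral_map h, hs, integral_smul_nnreal_measure]
    have : (s : ℂ) ≠ 0 := by exact_mod_cast hs0
    rw [NNReal.smul_def, Complex.real_smul]
    push_cast
    field_simp
  refine ⟨(s : ℝ)⁻¹, hκ, fun z hz => ?_⟩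
  refine IsBergmanKernel.eq_on hK
    (K' := fun z w => ((s : ℝ)⁻¹ : ℝ) * kernel D (L z + c) (L w + c)) ?_ hz hz
  intro w hw
  obtain ⟨h1, h2⟩ := hK (L w + c) ((hT w).2 hw)
  have h3 := memBergmanSpace_comp_affine hD L c hT h1
  refine ⟨⟨h3.1.const_mul _, h3.2.const_mul _⟩, fun f hf => ?_⟩
  have h4 := h2 _ (memBergmanSpace_comp_affine hD L.symm (-L.symm c) hT' hf)
  rw [hint] at h4
  simp only [map_add, L.symm_apply_apply, add_neg_cancel_right] at h4
  rw [h4, ← integral_const_mul]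
  congr 1
  ext z
  simp only [star_mul', Complex.star_def, Complex.conj_ofReal]
  ring

/-- The Bergman metric is invariant under affine automorphisms. -/
theorem metric_affine (hD : IsOpen D) (h0 : ∀ p ∈ D, ∃ f : E → ℂ, MemBergmanSpace D f ∧ f p ≠ 0)
    (L : E ≃L[ℂ] E) (c : E) (hT : ∀ z, L z + c ∈ D ↔ z ∈ D) {p : E} (hp : p ∈ D) (X : E) :
    metric D (L p + c) (L X) = metric D p X := by
  obtain ⟨κ, hκ, hK⟩ := kernel_affine hD L c hT
  set u : E → ℝ := fun z => Real.log (kernel D z z).re with hu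
  have hadd : ∀ z ∈ D, u z = u (L z + c) + Real.log κ := by
    intro z hz
    have hTz := (hT z).2 hz
    have h1 := (kernel_re_pos hD hTz (h0 _ hTz)).ne'
    simp only [hu]
    rw [hK z hz, Complex.re_ofReal_mul, Real.log_mul hκ.ne' h1, add_comm]
  have heq : u =ᶠ[𝓝 p] fun z => u (L z + c) + Real.log κ :=
    eventually_of_mem (hD.mem_nhds hp) hadd
  have hiter : ∀ Y : E, iteratedFDeriv ℝ 2 u p ![Y, Y] =
      iteratedFDeriv ℝ 2 u (L p + c) ![L Y, L Y] := by
    intro Y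
    rw [(heq.iteratedFDeriv ℝ 2).self_of_nhds]
    have h1 : iteratedFDeriv ℝ 2 (fun z => u (L z + c) + Real.log κ) p ![Y, Y] =
        iteratedFDeriv ℝ 2 (fun z => u (L z + c)) p ![Y, Y] := by
      rw [iteratedFDeriv_two_apply, iteratedFDeriv_two_apply]
      have : fderiv ℝ (fun z => u (L z + c) + Real.log κ) = fderiv ℝ (fun z => u (L z + c)) :=
        funext fun z => fderiv_add_const _
      rw [this]
    let LR : E ≃L[ℝ] E := L.restrictScalars ℝ
    have h2 : iteratedFDeriv ℝ 2 (fun z => u (L z + c)) p =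
        (iteratedFDeriv ℝ 2 (fun z => u (z + c)) (LR p)).compContinuousLinearMap
          fun _ => (LR : E →L[ℝ] E) := by
      simp only [← iteratedFDerivWithin_univ]
      exact LR.iteratedFDerivWithin_comp_right (fun z => u (z + c)) uniqueDiffOn_univ
        (mem_univ _) 2
    rw [h1, h2, iteratedFDeriv_comp_add_right]
    rw [ContinuousMultilinearMap.compContinuousLinearMap_apply]
    congr 1
    ext i
    fin_cases i <;> rfl
  rw [metric, metric, leviForm, leviForm, hiter, hiter, map_smul]

end Affine

/-- A domain on which finitely many complex linear functionals have positive imaginary part and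
control the norm has square integrable holomorphic functions without zeros. -/
theorem exists_memBergmanSpace_ne_zero {E : Type*} [NormedAddCommGroup E] [NormedSpace ℂ E]
    [FiniteDimensional ℂ E] {D : Set E} (hD : IsOpen D) {ι : Type*} [Fintype ι]
    (a : ι → E →L[ℂ] ℂ) (ha : ∀ z ∈ D, ∀ j, 0 < (a j z).im) {C : ℝ} (hC : 0 ≤ C)
    (haC : ∀ z ∈ D, ‖z‖ ≤ C * (1 + ∑ j, ‖a j z‖)) :
    ∃ f : E → ℂ, MemBergmanSpace D f ∧ ∀ p ∈ D, f p ≠ 0 := by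
  let : MeasurableSpace E := borel E
  have : BorelSpace E := ⟨rfl⟩
  have : ProperSpace E := FiniteDimensional.proper ℂ E
  have : FiniteDimensional ℝ E := FiniteDimensional.complexToReal E
  have : (lebesgue E).IsAddHaarMeasure := by
    unfold lebesgue
    infer_instance
  set m := Module.finrank ℝ E + 1 with hm
  set P : E → ℂ := fun z => ∏ j, (a j z + Complex.I) with hP
  have ht : ∀ z ∈ D, ∀ j, 1 ≤ ‖a j z + Complex.I‖ := by
    intro z hz j
    have h1 := Complex.abs_im_le_norm (a j z + Complex.I)
    have h2 := ha z hz j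
    rw [Complex.add_im, Complex.I_im, abs_of_pos (by linarith)] at h1
    linarith
  have hPn : ∀ z, ‖P z‖ = ∏ j, ‖a j z + Complex.I‖ := fun z => norm_prod _ _
  have hP1 : ∀ z ∈ D, 1 ≤ ‖P z‖ := fun z hz => by
    rw [hPn]
    exact Finset.prod_induction _ (fun x : ℝ => 1 ≤ x)
      (fun _ _ => one_le_mul_of_one_le_of_one_le) le_rfl fun j _ => ht z hz j
  have hjP : ∀ z ∈ D, ∀ j, ‖a j z + Complex.I‖ ≤ ‖P z‖ := fun z hz j => by
    classical
    rw [hPn, ← Finset.mul_prod_erase _ _ (Finset.mem_univ j)]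
    exact le_mul_of_one_le_right (norm_nonneg _)
      (Finset.prod_induction _ (fun x : ℝ => 1 ≤ x) (fun _ _ => one_le_mul_of_one_le_of_one_le)
        le_rfl fun j _ => ht z hz j)
  set M : ℝ := 1 + C * (1 + Fintype.card ι * 2) with hM
  have hM0 : 0 < M := by positivity
  have hbound : ∀ z ∈ D, 1 + ‖z‖ ≤ M * ‖P z‖ := by
    intro z hz
    have h1 := hP1 z hz
    have h2 : ∀ j, ‖a j z‖ ≤ 2 * ‖P z‖ := fun j => by
      have := norm_sub_le (a j z + Complex.I) Complex.I
      rw [add_sub_cancel_right, Complex.norm_I] at this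
      linarith [hjP z hz j]
    have h3 : ∑ j, ‖a j z‖ ≤ Fintype.card ι * (2 * ‖P z‖) := by
      refine (Finset.sum_le_sum fun j _ => h2 j).trans (le_of_eq ?_)
      simp
    calc 1 + ‖z‖ ≤ ‖P z‖ + C * (‖P z‖ + Fintype.card ι * (2 * ‖P z‖)) := by
          have := haC z hz
          have h4 : C * (1 + ∑ j, ‖a j z‖) ≤ C * (‖P z‖ + Fintype.card ι * (2 * ‖P z‖)) := by
            gcongr
          linarith
      _ = M * ‖P z‖ := by rw [hM]; ring
  have hne : ∀ z ∈ D, P z ≠ 0 := fun z hz h => by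
    have := hP1 z hz
    rw [h, norm_zero] at this
    linarith
  have hPd : Differentiable ℂ P := by
    intro z
    simp only [hP]
    fun_prop
  have hfd : DifferentiableOn ℂ (fun z => (P z ^ m)⁻¹) D := fun z hz =>
    ((hPd z).pow m).inv (pow_ne_zero m (hne z hz)) |>.differentiableWithinAt
  have hfm : AEStronglyMeasurable (fun z => (P z ^ m)⁻¹) ((lebesgue E).restrict D) :=
    hfd.continuousOn.aestronglyMeasurable hD.measurableSet
  refine ⟨fun z => (P z ^ m)⁻¹, ⟨hfd, ?_⟩, fun p hp => inv_ne_zero (pow_ne_zero m (hne p hp))⟩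
  refine (memLp_two_iff_integrable_sq_norm hfm).2 ?_
  have hint : Integrable (fun z : E => M ^ (m * 2) * (1 + ‖z‖) ^ (-((m * 2 : ℕ) : ℝ)))
      ((lebesgue E).restrict D) :=
    ((integrable_one_add_norm (μ := lebesgue E) (by
      rw [hm]
      push_cast
      linarith [(Nat.cast_nonneg (Module.finrank ℝ E) : (0 : ℝ) ≤ _)])).restrict).const_mul _
  refine hint.mono' (hfm.norm.pow 2) ?_
  filter_upwards [ae_restrict_mem hD.measurableSet] with z hz
  have h1 : 0 < 1 + ‖z‖ := by positivity
  have h2 : 0 < ‖P z‖ := norm_pos_iff.2 (hne z hz)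
  rw [Real.norm_of_nonneg (by positivity), norm_inv, norm_pow, inv_pow, ← pow_mul,
    Real.rpow_neg h1.le, Real.rpow_natCast, ← div_eq_mul_inv, inv_eq_one_div,
    div_le_div_iff₀ (by positivity) (by positivity), one_mul, ← mul_pow]
  exact pow_le_pow_left₀ h1.le (hbound z hz) _

end Bergman

/-! ## Quadratic forms of complex symmetric matrices -/

noncomputable section

section QuadraticForms

open Filter Topology

variable {ι : Type*} [Fintype ι]

/-- The value `ᵗv Z v` at a real vector `v`, as a functional of the complex matrix `Z`. -/
def quadVal (v : ι → ℝ) : Matrix ι ι ℂ →ₗ[ℂ] ℂ where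
  toFun Z := ∑ i, ∑ j, (v i * v j : ℂ) * Z i j
  map_add' Z Z' := by simp [mul_add, Finset.sum_add_distrib]
  map_smul' c Z := by simp [Finset.mul_sum, mul_left_comm]

theorem quadVal_apply (v : ι → ℝ) (Z : Matrix ι ι ℂ) :
    quadVal v Z = ∑ i, ∑ j, (v i * v j : ℂ) * Z i j := rfl

theorem quadVal_eq_dotProduct (v : ι → ℝ) (Z : Matrix ι ι ℂ) :
    quadVal v Z = (fun i => (v i : ℂ)) ⬝ᵥ Z *ᵥ fun i => (v i : ℂ) := by
  simp only [quadVal_apply, dotProduct, Matrix.mulVec, Finset.mul_sum]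
  exact Finset.sum_congr rfl fun i _ => Finset.sum_congr rfl fun j _ => by ring

theorem im_quadVal (v : ι → ℝ) (Z : Matrix ι ι ℂ) :
    (quadVal v Z).im = v ⬝ᵥ matIm Z *ᵥ v := by
  simp only [quadVal_apply, dotProduct, Matrix.mulVec, Finset.mul_sum, Complex.im_sum, matIm,
    Matrix.map_apply]
  refine Finset.sum_congr rfl fun i _ => Finset.sum_congr rfl fun j _ => ?_
  rw [← Complex.ofReal_mul, Complex.im_ofReal_mul]
  ring

theorem im_quadVal_pos {v : ι → ℝ} (hv : v ≠ 0) {Z : Matrix ι ι ℂ} (hZ : (matIm Z).PosDef) :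
    0 < (quadVal v Z).im := by
  rw [im_quadVal]
  simpa using hZ.dotProduct_mulVec_pos hv

theorem isOpen_setOf_forall_dotProduct_pos :
    IsOpen {A : Matrix ι ι ℝ | ∀ v ≠ 0, 0 < v ⬝ᵥ A *ᵥ v} := by
  have heq : {A : Matrix ι ι ℝ | ∀ v ≠ 0, 0 < v ⬝ᵥ A *ᵥ v} =
      {A | ∀ v ∈ Metric.sphere (0 : ι → ℝ) 1, 0 < v ⬝ᵥ A *ᵥ v} := by
    ext A
    refine ⟨fun h v hv => h v fun h0 => by simp [h0] at hv, fun h v hv => ?_⟩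
    have hn : 0 < ‖v‖ := norm_pos_iff.2 hv
    have := h (‖v‖⁻¹ • v) (by simp [norm_smul, hn.ne'])
    rw [Matrix.mulVec_smul, smul_dotProduct, dotProduct_smul, smul_smul, smul_eq_mul] at this
    exact pos_of_mul_pos_right this (by positivity)
  rw [heq, isOpen_iff_mem_nhds]
  intro A hA
  refine IsCompact.eventually_forall_of_forall_eventually (isCompact_sphere 0 1) fun v hv => ?_
  have hc : Continuous fun q : Matrix ι ι ℝ × (ι → ℝ) => q.2 ⬝ᵥ q.1 *ᵥ q.2 := by
    fun_prop
  exact hc.continuousAt.eventually_const_lt (hA v hv)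

theorem posDef_iff_isSymm_and {A : Matrix ι ι ℝ} :
    A.PosDef ↔ A.IsSymm ∧ ∀ v ≠ 0, 0 < v ⬝ᵥ A *ᵥ v := by
  rw [Matrix.posDef_iff_dotProduct_mulVec]
  simp [Matrix.IsHermitian, Matrix.IsSymm, Matrix.conjTranspose_eq_transpose_of_trivial]

variable [DecidableEq ι]

/-- The vector `e_i + e_j`. -/
def pairVec (p : ι × ι) : ι → ℝ := Pi.single p.1 1 + Pi.single p.2 1

theorem pairVec_ne_zero {κ : Type*} [DecidableEq κ] (p : κ × κ) : pairVec p ≠ 0 := by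
  intro h
  have h1 : (0 : ℝ) ≤ (Pi.single p.2 1 : κ → ℝ) p.1 := by
    rw [Pi.single_apply]
    split_ifs <;> norm_num
  have h2 := congrFun h p.1
  simp only [pairVec, Pi.add_apply, Pi.single_eq_same, Pi.zero_apply] at h2
  linarith

theorem quadVal_pairVec (i j : ι) (Z : Matrix ι ι ℂ) :
    quadVal (pairVec (i, j)) Z = Z i i + Z i j + Z j i + Z j j := by
  have h : (fun k => ((pairVec (i, j) k : ℝ) : ℂ)) = Pi.single i 1 + Pi.single j 1 := by
    ext k
    simp [pairVec, Pi.single_apply, apply_ite Complex.ofReal]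
  rw [quadVal_eq_dotProduct, h]
  simp [Matrix.mulVec_add, add_dotProduct, dotProduct_add]
  ring

theorem pairVec_dotProduct_self_le (p : ι × ι) : pairVec p ⬝ᵥ pairVec p ≤ 4 := by
  by_cases h : p.1 = p.2
  · simp [pairVec, h]
    norm_num
  · simp [pairVec, h, Ne.symm h]
    norm_num

/-- The entries of a symmetric matrix are controlled by finitely many values of its quadratic
form. -/
theorem norm_le_of_forall_quadVal_pairVec_le {Z : Matrix ι ι ℂ} (hZ : Z.IsSymm) {B : ℝ}
    (hB0 : 0 ≤ B) (hB : ∀ p, ‖quadVal (pairVec p) Z‖ ≤ B) : ‖Z‖ ≤ B := by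
  rw [Matrix.norm_le_iff hB0]
  intro i j
  have hij : Z i j = (1 / 2 : ℂ) * quadVal (pairVec (i, j)) Z -
      (1 / 8 : ℂ) * quadVal (pairVec (i, i)) Z - (1 / 8 : ℂ) * quadVal (pairVec (j, j)) Z := by
    rw [quadVal_pairVec, quadVal_pairVec, quadVal_pairVec, hZ.apply i j]
    ring
  rw [hij]
  refine (norm_sub_le _ _).trans ((add_le_add_left (norm_sub_le _ _) _).trans ?_)
  simp only [norm_mul]
  norm_num
  linarith [hB (i, j), hB (i, i), hB (j, j)]

theorem continuous_matIm {m n : Type*} [Fintype m] [Fintype n] :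
    Continuous (matIm : Matrix m n ℂ → Matrix m n ℝ) :=
  continuous_id.matrix_map Complex.continuous_im

theorem continuous_matRe {m n : Type*} [Fintype m] [Fintype n] :
    Continuous (matRe : Matrix m n ℂ → Matrix m n ℝ) :=
  continuous_id.matrix_map Complex.continuous_re

theorem matIm_isSymm {n : Type*} {Z : Matrix n n ℂ} (hZ : Z.IsSymm) : (matIm Z).IsSymm := by
  ext i j
  exact congrArg Complex.im (hZ.apply i j)

end QuadraticForms

/-! ## The Siegel upper half plane -/

section UpperHalfPlane

open Matrix
open scoped MatrixOrder

variable {n : ℕ}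

theorem isOpen_siegelUpperHalfPlane : IsOpen (siegelUpperHalfPlane n) := by
  have : siegelUpperHalfPlane n = (fun Z : symMatrices ℂ n => matIm (Z : Matrix (Fin n) (Fin n) ℂ)) ⁻¹'
      {A | ∀ v ≠ 0, 0 < v ⬝ᵥ A *ᵥ v} := by
    ext Z
    exact posDef_iff_isSymm_and.trans (and_iff_right (matIm_isSymm Z.2))
  rw [this]
  exact isOpen_setOf_forall_dotProduct_pos.preimage
    (continuous_matIm.comp continuous_subtype_val)

/-- `Z ↦ ᵗv Z v` as a continuous functional on symmetric matrices. -/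
def symQuadVal (v : Fin n → ℝ) : symMatrices ℂ n →L[ℂ] ℂ :=
  LinearMap.toContinuousLinearMap ((quadVal v).comp (symMatrices ℂ n).subtype)

theorem symQuadVal_apply (v : Fin n → ℝ) (Z : symMatrices ℂ n) :
    symQuadVal v Z = quadVal v (Z : Matrix _ _ ℂ) := rfl

theorem exists_memBergmanSpace_siegelUpperHalfPlane :
    ∃ f : symMatrices ℂ n → ℂ, Bergman.MemBergmanSpace (siegelUpperHalfPlane n) f ∧
      ∀ p ∈ siegelUpperHalfPlane n, f p ≠ 0 := by
  refine Bergman.exists_memBergmanSpace_ne_zero isOpen_siegelUpperHalfPlane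
    (fun p : Fin n × Fin n => symQuadVal (pairVec p)) (C := 1)
    (fun Z hZ p => im_quadVal_pos (pairVec_ne_zero p) hZ) zero_le_one fun Z _ => ?_
  rw [one_mul]
  have hs : 0 ≤ ∑ p : Fin n × Fin n, ‖symQuadVal (pairVec p) Z‖ :=
    Finset.sum_nonneg fun _ _ => norm_nonneg _
  refine norm_le_of_forall_quadVal_pairVec_le Z.2 (by positivity) fun p => ?_
  have := Finset.single_le_sum (f := fun p => ‖symQuadVal (pairVec p) Z‖)
    (fun _ _ => norm_nonneg _) (Finset.mem_univ p)
  exact this.trans (le_add_of_nonneg_left zero_le_one)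

/-- The congruence `Z ↦ ᵗB Z B` by an invertible real matrix. -/
def congruence (B : (Matrix (Fin n) (Fin n) ℝ)ˣ) : symMatrices ℂ n ≃L[ℂ] symMatrices ℂ n :=
  LinearEquiv.toContinuousLinearEquiv
    { toFun := fun Z => ⟨(B.1.map Complex.ofReal)ᵀ * Z * B.1.map Complex.ofReal, by
        change _ = _
        rw [transpose_mul, transpose_mul, transpose_transpose, Z.2, Matrix.mul_assoc]⟩
      map_add' := fun Z Z' => Subtype.ext (by simp [Matrix.mul_add, Matrix.add_mul])
      map_smul' := fun c Z => Subtype.ext (by simp)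
      invFun := fun Z => ⟨(B⁻¹.1.map Complex.ofReal)ᵀ * Z * B⁻¹.1.map Complex.ofReal, by
        change _ = _
        rw [transpose_mul, transpose_mul, transpose_transpose, Z.2, Matrix.mul_assoc]⟩
      left_inv := fun Z => Subtype.ext (by
        have h : B.1.map Complex.ofReal * B⁻¹.1.map Complex.ofReal = 1 :=
          (Matrix.map_mul (f := Complex.ofRealHom)).symm.trans (by rw [B.mul_inv]; simp)
        change _ᵀ * (_ᵀ * _ * _) * _ = _
        rw [Matrix.mul_assoc, Matrix.mul_assoc, Matrix.mul_assoc, h, ← Matrix.mul_assoc,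
          ← transpose_mul, h]
        simp)
      right_inv := fun Z => Subtype.ext (by
        have h : B⁻¹.1.map Complex.ofReal * B.1.map Complex.ofReal = 1 :=
          (Matrix.map_mul (f := Complex.ofRealHom)).symm.trans (by rw [B.inv_mul]; simp)
        change _ᵀ * (_ᵀ * _ * _) * _ = _
        rw [Matrix.mul_assoc, Matrix.mul_assoc, Matrix.mul_assoc, h, ← Matrix.mul_assoc,
          ← transpose_mul, h]
        simp) }

theorem congruence_apply (B : (Matrix (Fin n) (Fin n) ℝ)ˣ) (Z : symMatrices ℂ n) :
    (congruence B Z : Matrix (Fin n) (Fin n) ℂ) =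
      (B.1.map Complex.ofReal)ᵀ * Z * B.1.map Complex.ofReal := rfl

theorem matIm_congruence (B : (Matrix (Fin n) (Fin n) ℝ)ˣ) (Z : symMatrices ℂ n) :
    matIm (congruence B Z : Matrix (Fin n) (Fin n) ℂ) = (B.1)ᵀ * matIm (Z : Matrix _ _ ℂ) * B.1 := by
  ext i j
  simp [congruence_apply, matIm, Matrix.mul_apply, Complex.im_sum, Finset.sum_mul]

/-- The real part of a symmetric matrix. -/
def symRe (Z : symMatrices ℂ n) : symMatrices ℂ n :=
  ⟨(matRe (Z : Matrix _ _ ℂ)).map Complex.ofReal, by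
    change _ = _
    ext i j
    have h : (Z : Matrix (Fin n) (Fin n) ℂ) j i = (Z : Matrix (Fin n) (Fin n) ℂ) i j :=
      Matrix.IsSymm.apply Z.2 i j
    simp [matRe, h]⟩

theorem congruence_add_symRe_mem_iff (B : (Matrix (Fin n) (Fin n) ℝ)ˣ) (R Z : symMatrices ℂ n) :
    congruence B Z + symRe R ∈ siegelUpperHalfPlane n ↔ Z ∈ siegelUpperHalfPlane n := by
  have h : matIm ((congruence B Z + symRe R : symMatrices ℂ n) : Matrix (Fin n) (Fin n) ℂ) =
      star B.1 * matIm (Z : Matrix _ _ ℂ) * B.1 := by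
    rw [Matrix.star_eq_conjTranspose, Matrix.conjTranspose_eq_transpose_of_trivial,
      ← matIm_congruence]
    ext i j
    simp [matIm, symRe]
  change (matIm _).PosDef ↔ (matIm _).PosDef
  rw [h]
  exact B.isUnit.posDef_star_left_conjugate_iff

/-- The point `i I` of the Siegel upper half plane. -/
def basePoint (n : ℕ) : symMatrices ℂ n :=
  ⟨Complex.I • (1 : Matrix (Fin n) (Fin n) ℂ), Matrix.isSymm_one.smul _⟩

theorem matIm_basePoint : matIm (basePoint n : Matrix (Fin n) (Fin n) ℂ) = 1 := by
  ext i j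
  by_cases h : i = j
  · subst h
    simp [matIm, basePoint]
  · simp [matIm, basePoint, h]

theorem basePoint_mem : basePoint n ∈ siegelUpperHalfPlane n := by
  change (matIm _).PosDef
  rw [matIm_basePoint]
  exact Matrix.PosDef.one

/-- The affine automorphisms act transitively on the Siegel upper half plane. -/
theorem exists_congruence_basePoint {Q : symMatrices ℂ n} (hQ : Q ∈ siegelUpperHalfPlane n) :
    ∃ B : (Matrix (Fin n) (Fin n) ℝ)ˣ, congruence B (basePoint n) + symRe Q = Q := by
  have hQ' : (matIm (Q : Matrix (Fin n) (Fin n) ℂ)).PosDef := hQ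
  obtain ⟨B, hB⟩ := CStarAlgebra.nonneg_iff_eq_star_mul_self.1 hQ'.posSemidef.nonneg
  have hu : IsUnit B := by
    have h1 := hQ'.isUnit
    rw [hB, Matrix.isUnit_iff_isUnit_det, Matrix.det_mul] at h1
    rw [Matrix.isUnit_iff_isUnit_det]
    exact isUnit_of_mul_isUnit_right h1
  refine ⟨hu.unit, Subtype.ext ?_⟩
  have him := matIm_congruence hu.unit (basePoint n)
  rw [matIm_basePoint, Matrix.mul_one, IsUnit.unit_spec,
    ← Matrix.conjTranspose_eq_transpose_of_trivial, ← Matrix.star_eq_conjTranspose, ← hB] at him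
  have hre : matRe (congruence hu.unit (basePoint n) : Matrix (Fin n) (Fin n) ℂ) = 0 := by
    ext i j
    simp [congruence_apply, matRe, basePoint, Matrix.mul_apply, Complex.re_sum]
  ext i j
  apply Complex.ext
  · have := congrFun (congrFun hre i) j
    simp only [matRe, Matrix.map_apply, Matrix.zero_apply] at this
    simp [symRe, matRe, this]
  · have := congrFun (congrFun him i) j
    simp only [matIm, Matrix.map_apply] at this
    simp [symRe, matRe, this]

end UpperHalfPlane

end

/-! ## Homogeneous Siegel domains -/

noncomputable section

namespace SiegelData

open Matrix
open scoped MatrixOrder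

variable {r : ℕ} {ν : Fin r → ℕ} {ν₀ : ℕ}

theorem matRe_form_self (U : Matrix (Idx ν) (Fin ν₀) ℂ) :
    matRe (form U U) = (1 / 2 : ℝ) • (matRe U * (matRe U)ᵀ + matIm U * (matIm U)ᵀ) := by
  ext i j
  simp only [matRe, matIm, form, Matrix.map_apply, Matrix.smul_apply, Matrix.add_apply,
    Matrix.mul_apply, Matrix.transpose_apply, Matrix.conjTranspose_apply, smul_eq_mul]
  rw [show (1 / 4 : ℂ) = ((1 / 4 : ℝ) : ℂ) by norm_num, Complex.re_ofReal_mul, Complex.add_re,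
    Complex.re_sum, Complex.re_sum]
  simp only [Complex.star_def, Complex.mul_re, Complex.conj_re, Complex.conj_im]
  rw [← Finset.sum_add_distrib, ← Finset.sum_add_distrib, Finset.mul_sum, Finset.mul_sum]
  exact Finset.sum_congr rfl fun k _ => by ring

theorem posSemidef_matRe_form_self (U : Matrix (Idx ν) (Fin ν₀) ℂ) :
    (matRe (form U U)).PosSemidef := by
  rw [matRe_form_self]
  refine PosSemidef.smul (PosSemidef.add ?_ ?_) (by norm_num)
  · rw [← conjTranspose_eq_transpose_of_trivial]
    exact posSemidef_self_mul_conjTranspose _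
  · rw [← conjTranspose_eq_transpose_of_trivial]
    exact posSemidef_self_mul_conjTranspose _

variable (S : SiegelData r ν ν₀)

theorem matRe_form_self_mem_realSpace {U : Matrix (Idx ν) (Fin ν₀) ℂ} (hU : U ∈ S.complexSpace) :
    matRe (form U U) ∈ S.realSpace := by
  have hblock : ∀ l k : Fin r, (matRe (form U U)).submatrix (Sigma.mk l) (Sigma.mk k) =
      (1 / 2 : ℝ) • matRe (U.submatrix (Sigma.mk l) id * (U.submatrix (Sigma.mk k) id)ᴴ) := by
    intro l k
    rw [matRe_form_self]
    ext i j
    simp only [matRe, matIm, Matrix.map_apply, Matrix.smul_apply, Matrix.add_apply,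
      Matrix.mul_apply, Matrix.transpose_apply, Matrix.conjTranspose_apply, smul_eq_mul,
      Matrix.submatrix_apply, Complex.re_sum, id]
    rw [← Finset.sum_add_distrib]
    congr 1
    exact Finset.sum_congr rfl fun m _ => by simp
  refine ⟨?_, fun k => ?_, fun k l hkl => ?_⟩
  · have := (posSemidef_matRe_form_self U).isHermitian
    rwa [IsHermitian, conjTranspose_eq_transpose_of_trivial] at this
  · obtain ⟨c, hc⟩ := S.W3 k _ (hU k)
    refine ⟨c / 4, ?_⟩
    rw [hblock]
    ext i j
    have h := congrArg Complex.re (congrFun (congrFun hc i) j)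
    simp only [Matrix.add_apply, Matrix.mul_apply, Matrix.conjTranspose_apply, Complex.add_re,
      Complex.re_sum, Matrix.smul_apply, smul_eq_mul, Complex.re_ofReal_mul, Matrix.map_apply,
      Matrix.transpose_apply] at h
    have h1 : ((1 : Matrix (Fin (ν k)) (Fin (ν k)) ℂ) i j).re =
        (1 : Matrix (Fin (ν k)) (Fin (ν k)) ℝ) i j := by
      by_cases hij : i = j
      · subst hij
        simp
      · simp [hij]
    rw [h1, ← Finset.sum_add_distrib] at h
    simp only [matRe, Matrix.smul_apply, Matrix.map_apply, Matrix.mul_apply,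
      Matrix.conjTranspose_apply, Complex.re_sum, smul_eq_mul]
    rw [show c / 4 * (1 : Matrix (Fin (ν k)) (Fin (ν k)) ℝ) i j =
      (c * (1 : Matrix (Fin (ν k)) (Fin (ν k)) ℝ) i j) / 4 by ring, ← h, Finset.mul_sum,
      Finset.sum_div]
    refine Finset.sum_congr rfl fun m _ => ?_
    simp
    ring
  · rw [hblock]
    exact (S.V l k).smul_mem _ (S.W2 k l hkl _ (hU l) _ (hU k)).1

theorem mem_domain_iff (ζ : S.Ambient) : ζ ∈ S.domain ↔
    (matIm (ζ.1 : Matrix (Idx ν) (Idx ν) ℂ) -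
      matRe (form (ζ.2 : Matrix (Idx ν) (Fin ν₀) ℂ) ζ.2)).PosDef :=
  and_iff_right (S.realSpace.sub_mem ζ.1.2.2 (S.matRe_form_self_mem_realSpace ζ.2.2))

theorem isOpen_domain : IsOpen S.domain := by
  have : S.domain = (fun ζ : S.Ambient => matIm (ζ.1 : Matrix (Idx ν) (Idx ν) ℂ) -
      matRe (form (ζ.2 : Matrix (Idx ν) (Fin ν₀) ℂ) ζ.2)) ⁻¹'
      {A | ∀ v ≠ 0, 0 < v ⬝ᵥ A *ᵥ v} := by
    ext ζ
    rw [mem_domain_iff, posDef_iff_isSymm_and]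
    exact and_iff_right (S.realSpace.sub_mem ζ.1.2.2
      (S.matRe_form_self_mem_realSpace ζ.2.2)).1
  rw [this]
  refine isOpen_setOf_forall_dotProduct_pos.preimage ?_
  have h1 : Continuous fun ζ : S.Ambient => (ζ.1 : Matrix (Idx ν) (Idx ν) ℂ) := by fun_prop
  have h2 : Continuous fun ζ : S.Ambient => (ζ.2 : Matrix (Idx ν) (Fin ν₀) ℂ) := by fun_prop
  refine (continuous_matIm.comp h1).sub ?_
  simp only [matRe_form_self]
  have h3 := continuous_matRe.comp h2
  have h4 := continuous_matIm.comp h2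
  exact ((h3.matrix_mul h3.matrix_transpose).add
    (h4.matrix_mul h4.matrix_transpose)).const_smul (1 / 2 : ℝ)

theorem posDef_matIm_fst {ζ : S.Ambient} (hζ : ζ ∈ S.domain) :
    (matIm (ζ.1 : Matrix (Idx ν) (Idx ν) ℂ)).PosDef := by
  have := ((S.mem_domain_iff ζ).1 hζ).add_posSemidef
    (posSemidef_matRe_form_self (ζ.2 : Matrix (Idx ν) (Fin ν₀) ℂ))
  rwa [sub_add_cancel] at this

theorem posDef_matIm_embedding {ζ : S.Ambient} (hζ : ζ ∈ S.domain) :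
    (matIm (S.embedding ζ : Matrix (Fin (ν₀ + ∑ k, ν k)) (Fin (ν₀ + ∑ k, ν k)) ℂ)).PosDef := by
  obtain ⟨⟨Z, hZ⟩, ⟨U, hU⟩⟩ := ζ
  have hY := (S.mem_domain_iff _).1 hζ
  simp only at hY
  set P := matRe U
  set Q := matIm U
  set Y := matIm Z - matRe (form U U) with hYdef
  have hblocks : matIm (fromBlocks (Complex.I • (1 : Matrix (Fin ν₀) (Fin ν₀) ℂ)) Uᵀ U
      (Z - (Complex.I / 2) • (U * Uᵀ))) = fromBlocks 1 Qᵀ (Qᵀ)ᴴ (Y + Q * Qᵀ) := by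
    have h11 : matIm (Complex.I • (1 : Matrix (Fin ν₀) (Fin ν₀) ℂ)) = 1 := by
      ext i j
      by_cases h : i = j
      · subst h
        simp [matIm]
      · simp [matIm, h]
    have h22 : matIm (Z - (Complex.I / 2) • (U * Uᵀ)) = Y + Q * Qᵀ := by
      rw [hYdef, matRe_form_self]
      ext i j
      simp only [matIm, matRe, Matrix.map_apply, Matrix.sub_apply, Matrix.smul_apply,
        Matrix.mul_apply, Matrix.transpose_apply, smul_eq_mul, Matrix.add_apply, Complex.sub_im,
        Q]
      rw [show (Complex.I / 2 * ∑ k, U i k * U j k).im = 1 / 2 * (∑ k, U i k * U j k).re by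
        rw [show Complex.I / 2 = ((1 / 2 : ℝ) : ℂ) * Complex.I by push_cast; ring, mul_assoc,
          Complex.im_ofReal_mul, Complex.I_mul_im]]
      rw [Complex.re_sum]
      simp only [Complex.mul_re, Finset.sum_sub_distrib]
      ring
    refine (fromBlocks_map _ _ _ _ _).trans ?_
    change fromBlocks (matIm _) (matIm Uᵀ) (matIm U) (matIm _) = _
    rw [h11, h22, conjTranspose_eq_transpose_of_trivial, transpose_transpose]
    rfl
  have hpos : (fromBlocks 1 Qᵀ (Qᵀ)ᴴ (Y + Q * Qᵀ)).PosDef := by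
    have hPS : (fromBlocks 1 Qᵀ (Qᵀ)ᴴ (Y + Q * Qᵀ)).PosSemidef := by
      let : Invertible (1 : Matrix (Fin ν₀) (Fin ν₀) ℝ) := invertibleOne
      rw [PosDef.fromBlocks₁₁ _ _ PosDef.one, conjTranspose_eq_transpose_of_trivial,
        transpose_transpose, inv_one, Matrix.mul_one, add_sub_cancel_right]
      exact hY.posSemidef
    rw [hPS.posDef_iff_det_ne_zero, det_fromBlocks_one₁₁, conjTranspose_eq_transpose_of_trivial,
      transpose_transpose, add_sub_cancel_right]
    exact hY.det_pos.ne'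
  have hemb : matIm (S.embedding (⟨Z, hZ⟩, ⟨U, hU⟩) : Matrix _ _ ℂ) =
      (matIm (fromBlocks (Complex.I • (1 : Matrix (Fin ν₀) (Fin ν₀) ℂ)) Uᵀ U
      (Z - (Complex.I / 2) • (U * Uᵀ)))).submatrix (idxEquiv ν ν₀).symm (idxEquiv ν ν₀).symm := rfl
  rw [hemb, hblocks]
  exact hpos.submatrix (idxEquiv ν ν₀).symm.injective

theorem mapsTo_truncatedEmbedding (n : ℕ) (hn : n ≤ ν₀ + ∑ k, ν k) :
    Set.MapsTo (S.truncatedEmbedding n hn) S.domain (siegelUpperHalfPlane n) := fun _ hζ =>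
  (S.posDef_matIm_embedding hζ).submatrix (Fin.castLE_injective hn)

theorem exists_memBergmanSpace_domain :
    ∃ f : S.Ambient → ℂ, Bergman.MemBergmanSpace S.domain f ∧ ∀ p ∈ S.domain, f p ≠ 0 := by
  let a : Idx ν × Idx ν → S.Ambient →L[ℂ] ℂ := fun p => LinearMap.toContinuousLinearMap
    ((quadVal (pairVec p)).comp ((complexify S.realSpace).subtype.comp (LinearMap.fst ℂ (complexify S.realSpace) S.complexSpace)))
  have ha : ∀ p ζ, a p ζ = quadVal (pairVec p) (ζ.1 : Matrix (Idx ν) (Idx ν) ℂ) := fun p ζ => rfl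
  refine Bergman.exists_memBergmanSpace_ne_zero S.isOpen_domain a (C := 1)
    (fun ζ hζ p => im_quadVal_pos (pairVec_ne_zero p) (S.posDef_matIm_fst hζ)) zero_le_one
    fun ζ hζ => ?_
  rw [one_mul]
  set B := ∑ p, ‖a p ζ‖ with hB
  have hB0 : 0 ≤ B := Finset.sum_nonneg fun _ _ => norm_nonneg _
  have hZ : ‖(ζ.1 : Matrix (Idx ν) (Idx ν) ℂ)‖ ≤ B :=
    norm_le_of_forall_quadVal_pairVec_le (S.isSymm_of_mem ζ.1.2) hB0 fun p =>
      Finset.single_le_sum (f := fun p => ‖a p ζ‖) (fun _ _ => norm_nonneg _) (Finset.mem_univ p)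
  refine max_le (hZ.trans (le_add_of_nonneg_left zero_le_one)) ?_
  refine (norm_le_iff (A := (ζ.2 : Matrix (Idx ν) (Fin ν₀) ℂ)) (add_nonneg zero_le_one hB0)).2 fun i k => ?_
  have hpos := ((S.mem_domain_iff ζ).1 hζ).diag_pos (i := i)
  rw [matRe_form_self] at hpos
  simp only [matRe, matIm, Matrix.sub_apply, Matrix.smul_apply, Matrix.add_apply, Matrix.mul_apply,
    Matrix.map_apply, Matrix.transpose_apply, smul_eq_mul] at hpos
  rw [← Finset.sum_add_distrib] at hpos
  have h1 : ((ζ.2 : Matrix (Idx ν) (Fin ν₀) ℂ) i k).re * ((ζ.2 : Matrix (Idx ν) (Fin ν₀) ℂ) i k).re +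
      ((ζ.2 : Matrix (Idx ν) (Fin ν₀) ℂ) i k).im * ((ζ.2 : Matrix (Idx ν) (Fin ν₀) ℂ) i k).im ≤ _ :=
    Finset.single_le_sum (f := fun k =>
      ((ζ.2 : Matrix (Idx ν) (Fin ν₀) ℂ) i k).re * ((ζ.2 : Matrix (Idx ν) (Fin ν₀) ℂ) i k).re +
      ((ζ.2 : Matrix (Idx ν) (Fin ν₀) ℂ) i k).im * ((ζ.2 : Matrix (Idx ν) (Fin ν₀) ℂ) i k).im)
      (fun k _ => add_nonneg (mul_self_nonneg _) (mul_self_nonneg _)) (Finset.mem_univ k)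
  have h2 : ((ζ.1 : Matrix (Idx ν) (Idx ν) ℂ) i i).im ≤ B :=
    (Complex.abs_im_le_norm _).trans' (le_abs_self _) |>.trans
      ((norm_entry_le_entrywise_sup_norm _).trans hZ)
  have h3 : ‖(ζ.2 : Matrix (Idx ν) (Fin ν₀) ℂ) i k‖ ^ 2 ≤ (1 + B) ^ 2 := by
    rw [Complex.sq_norm, Complex.normSq_apply]
    nlinarith
  exact abs_le_of_sq_le_sq' h3 (add_nonneg zero_le_one hB0) |>.2

theorem differentiable_truncatedEmbedding (n : ℕ) (hn : n ≤ ν₀ + ∑ k, ν k) :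
    Differentiable ℂ (S.truncatedEmbedding n hn) := by
  obtain ⟨p, hp⟩ := LinearMap.exists_leftInverse_of_injective (symMatrices ℂ n).subtype
    (Submodule.ker_subtype _)
  let q : Matrix (Fin n) (Fin n) ℂ →L[ℂ] symMatrices ℂ n := LinearMap.toContinuousLinearMap p
  have hq : S.truncatedEmbedding n hn = fun ζ =>
      q (S.truncatedEmbedding n hn ζ : Matrix (Fin n) (Fin n) ℂ) := by
    ext1 ζ
    exact (LinearMap.congr_fun hp (S.truncatedEmbedding n hn ζ)).symm
  have hent : ∀ i j, Differentiable ℂ fun ζ : S.Ambient => fromBlocks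
      (Complex.I • (1 : Matrix (Fin ν₀) (Fin ν₀) ℂ)) (ζ.2 : Matrix (Idx ν) (Fin ν₀) ℂ)ᵀ
      (ζ.2 : Matrix (Idx ν) (Fin ν₀) ℂ)
      ((ζ.1 : Matrix (Idx ν) (Idx ν) ℂ) - (Complex.I / 2) •
        ((ζ.2 : Matrix (Idx ν) (Fin ν₀) ℂ) * (ζ.2 : Matrix (Idx ν) (Fin ν₀) ℂ)ᵀ)) i j := by
    have hU : ∀ i k, Differentiable ℂ fun ζ : S.Ambient =>
        (ζ.2 : Matrix (Idx ν) (Fin ν₀) ℂ) i k := fun i k =>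
      (LinearMap.toContinuousLinearMap ((entryLinearMap ℂ ℂ i k).comp
        (S.complexSpace.subtype.comp (LinearMap.snd ℂ (complexify S.realSpace) S.complexSpace)))).differentiable
    have hZ : ∀ i k, Differentiable ℂ fun ζ : S.Ambient =>
        (ζ.1 : Matrix (Idx ν) (Idx ν) ℂ) i k := fun i k =>
      (LinearMap.toContinuousLinearMap ((entryLinearMap ℂ ℂ i k).comp
        ((complexify S.realSpace).subtype.comp (LinearMap.fst ℂ (complexify S.realSpace) S.complexSpace)))).differentiable
    rintro (i | i) (j | j)
    · exact differentiable_const _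
    · exact hU j i
    · exact hU i j
    · simp only [fromBlocks_apply₂₂, Matrix.sub_apply, Matrix.smul_apply, Matrix.mul_apply,
        Matrix.transpose_apply]
      exact (hZ i j).fun_sub
        ((Differentiable.fun_sum fun k _ => (hU i k).fun_mul (hU j k)).fun_const_smul _)
  rw [hq]
  refine q.differentiable.comp ?_
  refine differentiable_pi.2 fun i => differentiable_pi.2 fun j => ?_
  exact hent _ _

end SiegelData

end

/-! ## Comparison of the Bergman metrics -/

theorem Bergman.exists_metric_le {E : Type*} [NormedAddCommGroup E] [NormedSpace ℂ E]
    [FiniteDimensional ℂ E] (D : Set E) (p : E) :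
    ∃ C : ℝ, 0 ≤ C ∧ ∀ X, Bergman.metric D p X ≤ C * ‖X‖ ^ 2 := by
  set T := iteratedFDeriv ℝ 2 (fun z => Real.log (Bergman.kernel D z z).re) p
  refine ⟨‖T‖, norm_nonneg _, fun X => ?_⟩
  have h : ∀ Y : E, T ![Y, Y] ≤ ‖T‖ * ‖Y‖ ^ 2 := fun Y => by
    refine (le_abs_self _).trans ((T.le_opNorm ![Y, Y]).trans (le_of_eq ?_))
    simp [Fin.prod_univ_two, sq]
  have h1 := h X
  have h2 := h (Complex.I • X)
  rw [norm_smul, Complex.norm_I, one_mul] at h2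
  have h3 : Bergman.metric D p X = (T ![X, X] + T ![Complex.I • X, Complex.I • X]) / 4 := rfl
  rw [h3]
  nlinarith [mul_nonneg (norm_nonneg T) (sq_nonneg ‖X‖)]

theorem Bergman.metric_nonneg {E : Type*} [NormedAddCommGroup E] [NormedSpace ℂ E]
    [FiniteDimensional ℂ E] {D : Set E} (hD : IsOpen D) {p : E} (hp : p ∈ D)
    (h0 : ∃ f : E → ℂ, Bergman.MemBergmanSpace D f ∧ f p ≠ 0) (X : E) :
    0 ≤ Bergman.metric D p X := by
  simpa using Bergman.norm_fderiv_sq_le_metric hD hp h0 (F := fun _ => 0)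
    (differentiableOn_const 0) (by simp) rfl X

/-- A holomorphic map that expands the Bergman metric by a bounded factor is Lipschitz for the
Bergman distance. -/
theorem Bergman.dist_le_of_metric_le {E F : Type*} [NormedAddCommGroup E] [NormedSpace ℂ E]
    [FiniteDimensional ℂ E] [NormedAddCommGroup F] [NormedSpace ℂ F] [FiniteDimensional ℂ F]
    {D : Set E} {D' : Set F} {Φ : E → F} (hd : Differentiable ℂ Φ) (hmaps : Set.MapsTo Φ D D')
    {M : ℝ≥0} (hM : M ≠ 0) (hmet : ∀ z ∈ D, ∀ X,
      Bergman.metric D' (Φ z) (fderiv ℂ Φ z X) ≤ (M : ℝ) ^ 2 * Bergman.metric D z X) (z w : E) :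
    Bergman.dist D' (Φ z) (Φ w) ≤ M * Bergman.dist D z w := by
  have : CompleteSpace F := FiniteDimensional.complete ℂ F
  have hcd : ContDiff ℝ 1 Φ := by
    rw [← contDiffOn_univ]
    exact (DifferentiableOn.contDiffOn_complex isOpen_univ 1
      hd.differentiableOn).restrict_scalars ℝ
  have hM0 : (M : ℝ≥0∞) ≠ 0 := ENNReal.coe_ne_zero.2 hM
  rw [Bergman.dist, Bergman.dist, ENNReal.mul_iInf_of_ne hM0 ENNReal.coe_ne_top]
  refine le_iInf fun γ => ?_
  rw [ENNReal.mul_iInf_of_ne hM0 ENNReal.coe_ne_top]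
  refine le_iInf fun hγ => ?_
  obtain ⟨hγc, hγm, hγ0, hγ1⟩ := hγ
  refine (iInf₂_le (Φ ∘ γ) ⟨hcd.comp_contDiffOn hγc, hmaps.comp hγm, by simp [hγ0],
    by simp [hγ1]⟩).trans ?_
  rw [Bergman.curveLength, Bergman.curveLength, ← MeasureTheory.lintegral_const_mul' _ _
    ENNReal.coe_ne_top]
  refine MeasureTheory.setLIntegral_mono' measurableSet_Icc fun t ht => ?_
  have hder : derivWithin (Φ ∘ γ) (Set.Icc 0 1) t =
      fderiv ℂ Φ (γ t) (derivWithin γ (Set.Icc 0 1) t) := by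
    have h1 : HasDerivWithinAt γ (derivWithin γ (Set.Icc 0 1) t) (Set.Icc 0 1) t :=
      ((hγc.differentiableOn (by norm_num)) t ht).hasDerivWithinAt
    have h2 : HasFDerivAt Φ ((fderiv ℂ Φ (γ t)).restrictScalars ℝ) (γ t) :=
      (hd (γ t)).hasFDerivAt.restrictScalars ℝ
    exact (h2.comp_hasDerivWithinAt t h1).derivWithin (uniqueDiffOn_Icc one_pos t ht)
  have hle := hmet (γ t) (hγm ht) (derivWithin γ (Set.Icc 0 1) t)
  rw [hder, Function.comp_apply, ← ENNReal.ofReal_coe_nnreal, ← ENNReal.ofReal_mul (NNReal.coe_nonneg M)]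
  refine ENNReal.ofReal_le_ofReal ((Real.sqrt_le_sqrt hle).trans (le_of_eq ?_))
  rw [Real.sqrt_mul (by positivity), Real.sqrt_sq (NNReal.coe_nonneg M)]

/-- The Cayley transform based at a point of the upper half plane maps the upper half plane to the
unit disk. -/
theorem norm_cayley_le_one {z α : ℂ} (hz : 0 < z.im) (hα : 0 < α.im) :
    ‖(z - α) / (z - star α)‖ ≤ 1 := by
  have h0 : 0 < ‖z - star α‖ := by
    refine norm_pos_iff.2 fun h => ?_
    have := congrArg Complex.im h
    simp at this
    linarith
  rw [norm_div, div_le_one h0]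
  refine abs_le_of_sq_le_sq' ?_ (norm_nonneg _) |>.2
  rw [Complex.sq_norm, Complex.sq_norm, Complex.normSq_apply, Complex.normSq_apply]
  simp
  nlinarith [mul_pos hz hα]

open Topology in
/-- The Bergman metric dominates the pullbacks of the Poincaré metric of the upper half plane. -/
theorem Bergman.norm_fderiv_div_im_sq_le_metric {E : Type*} [NormedAddCommGroup E]
    [NormedSpace ℂ E] [FiniteDimensional ℂ E] {D : Set E} (hD : IsOpen D) {p : E} (hp : p ∈ D)
    (h0 : ∃ f : E → ℂ, Bergman.MemBergmanSpace D f ∧ f p ≠ 0) {g : E → ℂ}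
    (hg : DifferentiableOn ℂ g D) (hpos : ∀ z ∈ D, 0 < (g z).im) (X : E) :
    (‖fderiv ℂ g p X‖ / (2 * (g p).im)) ^ 2 ≤ Bergman.metric D p X := by
  have hgp : DifferentiableAt ℂ g p := hg.differentiableAt (hD.mem_nhds hp)
  have hne : ∀ z ∈ D, g z - star (g p) ≠ 0 := fun z hz h => by
    have h1 := congrArg Complex.im h
    simp at h1
    linarith [hpos z hz, hpos p hp]
  have hdiff : DifferentiableOn ℂ (fun z => (g z - g p) / (g z - star (g p))) D := by
    simp only [div_eq_mul_inv]
    exact (hg.sub_const (g p)).fun_mul ((hg.sub_const (star (g p))).fun_inv hne)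
  have hkey := Bergman.norm_fderiv_sq_le_metric hD hp h0 hdiff
    (fun z hz => norm_cayley_le_one (hpos z hz) (hpos p hp)) (by simp) X
  have hfd : fderiv ℂ (fun z => (g z - g p) / (g z - star (g p))) p X =
      fderiv ℂ g p X / (g p - star (g p)) := by
    have hmul : (fun z => g z - g p) =ᶠ[𝓝 p]
        fun z => (g z - g p) / (g z - star (g p)) * (g z - star (g p)) := by
      filter_upwards [hD.mem_nhds hp] with z hz
      rw [div_mul_cancel₀ _ (hne z hz)]
    have h1 := hmul.fderiv_eq (𝕜 := ℂ)
    rw [fderiv_fun_mul (hdiff.differentiableAt (hD.mem_nhds hp)) (hgp.sub_const _),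
      fderiv_sub_const] at h1
    rw [eq_div_iff (hne p hp), h1]
    simp [mul_comm]
  rw [hfd, norm_div] at hkey
  have h2 : ‖g p - star (g p)‖ = 2 * (g p).im := by
    rw [Complex.star_def, Complex.sub_conj]
    simp [abs_of_pos (hpos p hp)]
  rwa [h2] at hkey

namespace SiegelData

variable {r : ℕ} {ν : Fin r → ℕ} {ν₀ : ℕ} (S : SiegelData r ν ν₀)

open Topology Matrix

theorem norm_symQuadVal_sq_le_metric (n : ℕ) (hn : n ≤ ν₀ + ∑ k, ν k) {ζ : S.Ambient}
    (hζ : ζ ∈ S.domain) {v : Fin n → ℝ} (hv : v ≠ 0) (X : S.Ambient) :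
    (‖symQuadVal v (fderiv ℂ (S.truncatedEmbedding n hn) ζ X)‖ /
      (2 * (symQuadVal v (S.truncatedEmbedding n hn ζ)).im)) ^ 2 ≤
        Bergman.metric S.domain ζ X := by
  obtain ⟨f, hf, hf0⟩ := S.exists_memBergmanSpace_domain
  have hΦ := S.differentiable_truncatedEmbedding n hn
  have hgf : fderiv ℂ (fun η => symQuadVal v (S.truncatedEmbedding n hn η)) ζ X =
      symQuadVal v (fderiv ℂ (S.truncatedEmbedding n hn) ζ X) := by
    have : HasFDerivAt (fun η => symQuadVal v (S.truncatedEmbedding n hn η))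
        ((symQuadVal v).comp (fderiv ℂ (S.truncatedEmbedding n hn) ζ)) ζ :=
      (symQuadVal v).hasFDerivAt.comp ζ (hΦ ζ).hasFDerivAt
    rw [this.fderiv]
    rfl
  rw [← hgf]
  exact Bergman.norm_fderiv_div_im_sq_le_metric S.isOpen_domain hζ ⟨f, hf, hf0 ζ hζ⟩
    ((symQuadVal v).differentiable.comp hΦ).differentiableOn
    (fun η hη => im_quadVal_pos hv (S.mapsTo_truncatedEmbedding n hn hη)) X

theorem metric_truncatedEmbedding_le (n : ℕ) (hn : n ≤ ν₀ + ∑ k, ν k) :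
    ∃ C : ℝ, 0 ≤ C ∧ ∀ ζ ∈ S.domain, ∀ X : S.Ambient,
      Bergman.metric (siegelUpperHalfPlane n) (S.truncatedEmbedding n hn ζ)
        (fderiv ℂ (S.truncatedEmbedding n hn) ζ X) ≤ C * Bergman.metric S.domain ζ X := by
  obtain ⟨C, hC, hCX⟩ := Bergman.exists_metric_le (siegelUpperHalfPlane n) (basePoint n)
  refine ⟨C * 64, by positivity, fun ζ hζ X => ?_⟩
  set Q := S.truncatedEmbedding n hn ζ with hQ
  set Y := fderiv ℂ (S.truncatedEmbedding n hn) ζ X with hY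
  obtain ⟨B, hB⟩ := exists_congruence_basePoint (S.mapsTo_truncatedEmbedding n hn hζ)
  obtain ⟨f, hf, hf0⟩ := exists_memBergmanSpace_siegelUpperHalfPlane (n := n)
  set Y' := (congruence B).symm Y with hY'
  have hYY' : congruence B Y' = Y := (congruence B).apply_symm_apply Y
  have hmet : Bergman.metric (siegelUpperHalfPlane n)
      (congruence B (basePoint n) + symRe Q) (congruence B Y') =
      Bergman.metric (siegelUpperHalfPlane n) (basePoint n) Y' := Bergman.metric_affine isOpen_siegelUpperHalfPlane (fun p hp => ⟨f, hf, hf0 p hp⟩)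
    (congruence B) (symRe Q) (congruence_add_symRe_mem_iff B Q) basePoint_mem Y'
  rw [← hQ] at hB
  rw [hB, hYY'] at hmet
  obtain ⟨f', hf', hf0'⟩ := S.exists_memBergmanSpace_domain
  have hm0 : 0 ≤ Bergman.metric S.domain ζ X :=
    Bergman.metric_nonneg S.isOpen_domain hζ ⟨f', hf', hf0' ζ hζ⟩ X
  have hbound : ‖Y'‖ ≤ 8 * Real.sqrt (Bergman.metric S.domain ζ X) := by
    refine norm_le_of_forall_quadVal_pairVec_le Y'.2 (by positivity) fun p => ?_
    set w := pairVec p with hw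
    set v : Fin n → ℝ := B⁻¹.1 *ᵥ w with hv
    have hBv : B.1 *ᵥ v = w := by
      rw [hv, Matrix.mulVec_mulVec, B.mul_inv, Matrix.one_mulVec]
    have hv0 : v ≠ 0 := fun h => pairVec_ne_zero p (by rw [← hw, ← hBv, h, Matrix.mulVec_zero])
    have hcong : ∀ Z : symMatrices ℂ n, symQuadVal v (congruence B Z) = symQuadVal w Z := by
      intro Z
      have hcast : (fun i => ((w i : ℝ) : ℂ)) = B.1.map Complex.ofReal *ᵥ fun i => (v i : ℂ) := by
        ext i
        rw [← hBv]
        simp [Matrix.mulVec, dotProduct]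
      rw [symQuadVal_apply, symQuadVal_apply, quadVal_eq_dotProduct, quadVal_eq_dotProduct, hcast,
        congruence_apply, ← Matrix.mulVec_mulVec, ← Matrix.mulVec_mulVec,
        Matrix.dotProduct_mulVec, Matrix.vecMul_transpose]
    have him : (symQuadVal v Q).im = w ⬝ᵥ w := by
      have h1 : (symQuadVal v (symRe Q)).im = 0 := by
        have h2 : matIm (symRe Q : Matrix (Fin n) (Fin n) ℂ) = 0 := by
          ext i j
          simp [matIm, symRe]
        rw [symQuadVal_apply, im_quadVal, h2]
        simp
      rw [← hB, map_add, Complex.add_im, h1, add_zero, hcong, symQuadVal_apply, im_quadVal,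
        matIm_basePoint, Matrix.one_mulVec]
    have hk := S.norm_symQuadVal_sq_le_metric n hn hζ hv0 X
    rw [← hY, ← hQ, him, ← hYY', hcong] at hk
    have hw4 := pairVec_dotProduct_self_le p
    have hwpos : 0 < w ⬝ᵥ w := by
      rw [← him]
      exact im_quadVal_pos hv0 (S.mapsTo_truncatedEmbedding n hn hζ)
    have h3 := Real.le_sqrt_of_sq_le hk
    rw [div_le_iff₀ (by positivity)] at h3
    refine h3.trans ?_
    nlinarith [Real.sqrt_nonneg (Bergman.metric S.domain ζ X)]
  rw [hmet]
  refine (hCX Y').trans ?_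
  calc C * ‖Y'‖ ^ 2 ≤ C * (8 * Real.sqrt (Bergman.metric S.domain ζ X)) ^ 2 := by gcongr
    _ = C * 64 * Bergman.metric S.domain ζ X := by
      rw [mul_pow, Real.sq_sqrt hm0]
      ring

end SiegelData

theorem proposition3p2 {r : ℕ} (hr : 1 ≤ r) {ν : Fin r → ℕ} (hν : ∀ k, 0 < ν k)
    {ν₀ : ℕ} (hν₀ : 0 < ν₀) (S : SiegelData r ν ν₀)
    (n : ℕ) (hn : 1 ≤ n) (hnN : n ≤ ν₀ + ∑ k, ν k) :
    Set.MapsTo (S.truncatedEmbedding n hnN) S.domain (siegelUpperHalfPlane n) ∧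
    ∃ M : ℝ≥0, 0 < M ∧ ∀ ζ ∈ S.domain, ∀ η ∈ S.domain,
      Bergman.dist (siegelUpperHalfPlane n)
          (S.truncatedEmbedding n hnN ζ) (S.truncatedEmbedding n hnN η) ≤
        M * Bergman.dist S.domain ζ η := by
  have hmaps := S.mapsTo_truncatedEmbedding n hnN
  refine ⟨hmaps, ?_⟩
  obtain ⟨C, hC, hmet⟩ := S.metric_truncatedEmbedding_le n hnN
  have hM0 : Real.toNNReal (Real.sqrt C + 1) ≠ 0 := by
    rw [Ne, Real.toNNReal_eq_zero, not_le]
    positivity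
  refine ⟨_, pos_iff_ne_zero.2 hM0, fun ζ _ η _ => Bergman.dist_le_of_metric_le
    (S.differentiable_truncatedEmbedding n hnN) hmaps hM0 (fun z hz X => (hmet z hz X).trans ?_)
    ζ η⟩
  obtain ⟨f, hf, hf0⟩ := S.exists_memBergmanSpace_domain
  refine mul_le_mul_of_nonneg_right ?_
    (Bergman.metric_nonneg S.isOpen_domain hz ⟨f, hf, hf0 z hz⟩ X)
  rw [Real.coe_toNNReal _ (by positivity)]
  nlinarith [Real.sq_sqrt hC, Real.sqrt_nonneg C]
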